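/- Let $P$ be a finite poset with at least two elements that is irreducible with respect to ordinal sum, i.e. $P$ is not the ordinal sum $A\oplus B$ of two proper subposets $A,B\subsetneq P$ (here $P=A\oplus B$ means that $P$ is the disjoint union of $A$ and $B$ and that $a<b$ for all $a\in A$, $b\in B$). Let $L(P)$ be the distributive lattice of all poset ideals (down-closed subsets) of $P$, ordered by inclusion, let $\Bbbk$ be a field, and let $S=\Bbbk[x_\alpha \mid \alpha\in L(P)]$. Put $$f_{\alpha,\beta}=x_\alpha x_\beta-x_{\alpha\wedge\beta}\,x_{\alpha\vee\beta},\qquad \mathcal F=\{f_{\alpha,\beta}\mid \alpha,\beta\in L(P)\text{ incomparable}\},\qquad \mathcal R=\Bbbk[\mathcal F]\subseteq S .$$ A monomial order $\preceq$ on $S$ is called compatible if $\mathrm{in}_\preceq(f_{\alpha,\beta})=x_\alpha x_\beta$ for all incomparable $\alpha,\beta\in L(P)$. The set $\mathcal F$ is a Khovanskii (SAGBI) basis of $\mathcal R$ with respect to $\preceq$ if $\{\mathrm{in}_\preceq(f)\mid f\in\mathcal F\}$ generates, as a $\Bbbk$-algebra, the initial algebra $\mathrm{in}_\preceq(\mathcal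 R)$, the $\Bbbk$-span of $\{\mathrm{in}_\preceq(f)\mid f\in\mathcal R\}$. The following conditions are equivalent: (1) $\mathcal F$ is a Khovanskii basis of $\mathcal R$ with respect to some compatible monomial order; (1') $\mathcal F$ is a Khovanskii basis of $\mathcal R$ with respect to every compatible monomial order; (2) $P$ is $\{(2+2),(1+1+1)\}$-free, i.e. no induced subposet of $P$ is a disjoint union of two mutually incomparable 2-element chains or a 3-element antichain; (3) $L(P)$ is isomorphic to a generalized snake poset $P(w_0w_1\cdots w_l)$ for some $l\ge 0$, $w_0=\epsilon$ and $w_1,\dots,w_l\in\{L,R\}$. Here $P(w_0w_1\cdots w_l)$ is the poset on $\{\alpha_0,\dots,\alpha_{2l+3}\}$ defined recursively: $P(\epsilon)$ has the cover relations $\alpha_0\lessdot\alpha_1$, $\alpha_0\lessdot\alpha_2$, $\alpha_1\lessdot\alpha_3$, $\alpha_2\lessdot\alpha_3$; and $P(w_0\cdots w_l)$, $l\ge1$, is obtained from $P(w_0\cdots w_{l-1})$ by adding $\alpha_{2l+2},\alpha_{2l+3}$ with the cover relations $\alpha_{2l+1}\lessdot\alpha_{2l+3}$, $\alpha_{2l+2}\lessdot\alpha_{2l+3}$,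 and $\alpha_{2l-1}\lessdot\alpha_{2l+2}$ if ($l=1$ and $w_1=L$) or ($l\ge2$ and $w_{l-1}\ne w_l$), respectively $\alpha_{2l}\lessdot\alpha_{2l+2}$ if ($l=1$ and $w_1=R$) or ($l\ge2$ and $w_{l-1}=w_l$). -/

import Mathlib

namespace HibiKhovanskii

/-! ### Ordinal sums and forbidden subposets -/

/-- `P` is the ordinal sum of its subposets `A` and `B`. -/
def IsOrdinalSum {P : Type*} [PartialOrder P] (A B : Set P) : Prop :=
  Disjoint A B ∧ A ∪ B = Set.univ ∧
    ∀ a b : P, a ≤ b ↔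
      (a ∈ A ∧ b ∈ A ∧ a ≤ b) ∨ (a ∈ B ∧ b ∈ B ∧ a ≤ b) ∨ (a ∈ A ∧ b ∈ B)

/-- `P` is not the ordinal sum of two proper subposets. -/
def OrdinalSumIrreducible (P : Type*) [PartialOrder P] : Prop :=
  ¬ ∃ A B : Set P, A ≠ Set.univ ∧ B ≠ Set.univ ∧ IsOrdinalSum A B

/-- No subposet of `P` (with the induced order) is a disjoint union of two 2-element chains. -/
def TwoPlusTwoFree (P : Type*) [PartialOrder P] : Prop :=
  IsEmpty ((Fin 2 ⊕ Fin 2) ↪o P)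

/-- No subposet of `P` (with the induced order) is a 3-element antichain. -/
def OnePlusOnePlusOneFree (P : Type*) [PartialOrder P] : Prop :=
  IsEmpty ((Fin 1 ⊕ Fin 1 ⊕ Fin 1) ↪o P)

/-! ### Generalized snake posets -/

inductive SnakeLetter
  | L
  | R

/-- The covering relations of the generalized snake poset of the word `ε w₁ w₂ ⋯ w_l`, where the
natural number `i` stands for the element `α_i`. Only the letters `w 1, …, w l` matter. -/
def SnakeCover (w : ℕ → SnakeLetter) : ℕ → ℕ → ℕ → Prop
  | 0, i, j => (i = 0 ∧ j = 1) ∨ (i = 0 ∧ j = 2) ∨ (i = 1 ∧ j = 3) ∨ (i = 2 ∧ j = 3)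
  | l + 1, i, j =>
      SnakeCover w l i j ∨
      (i = 2 * (l + 1) + 1 ∧ j = 2 * (l + 1) + 3) ∨
      (i = 2 * (l + 1) + 2 ∧ j = 2 * (l + 1) + 3) ∨
      (((l + 1 = 1 ∧ w 1 = .L) ∨ (2 ≤ l + 1 ∧ w l ≠ w (l + 1))) ∧
        i = 2 * (l + 1) - 1 ∧ j = 2 * (l + 1) + 2) ∨
      (((l + 1 = 1 ∧ w 1 = .R) ∨ (2 ≤ l + 1 ∧ w l = w (l + 1))) ∧
        i = 2 * (l + 1) ∧ j = 2 * (l + 1) + 2)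

theorem SnakeCover.lt {w : ℕ → SnakeLetter} {l i j : ℕ} (h : SnakeCover w l i j) : i < j := by
  induction l with
  | zero => simp only [SnakeCover] at h; omega
  | succ l ih =>
    simp only [SnakeCover] at h
    rcases h with h | h
    · exact ih h
    · omega

/-- The underlying set `{α_0, …, α_{2l+3}}` of the generalized snake poset of `ε w₁ ⋯ w_l`. -/
structure SnakePoset (w : ℕ → SnakeLetter) (l : ℕ) where
  idx : Fin (2 * l + 4)

theorem SnakePoset.idx_le {w : ℕ → SnakeLetter} {l : ℕ} {a b : SnakePoset w l}
    (h : Relation.ReflTransGen (fun a b : SnakePoset w l => SnakeCover w l a.idx b.idx) a b) :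
    a.idx ≤ b.idx := by
  induction h with
  | refl => exact le_rfl
  | tail _ h ih => exact ih.trans (Fin.le_def.mpr h.lt.le)

/-- The order of the generalized snake poset is generated by its covering relations. -/
instance (w : ℕ → SnakeLetter) (l : ℕ) : PartialOrder (SnakePoset w l) where
  le := Relation.ReflTransGen (fun a b => SnakeCover w l a.idx b.idx)
  le_refl _ := Relation.ReflTransGen.refl
  le_trans _ _ _ := Relation.ReflTransGen.trans
  le_antisymm a b hab hba := by
    cases a
    cases b
    congr
    exact le_antisymm (SnakePoset.idx_le hab) (SnakePoset.idx_le hba)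

/-- `Q` is (isomorphic to) the generalized snake poset of some generalized snake word. -/
def IsGeneralizedSnakePoset (Q : Type*) [PartialOrder Q] : Prop :=
  ∃ (l : ℕ) (w : ℕ → SnakeLetter), Nonempty (Q ≃o SnakePoset w l)

/-! ### Khovanskii (SAGBI) bases

The lattice `L(P)` of poset ideals is Mathlib's `LowerSet P`, ordered by inclusion. -/

open MvPolynomial

/-- The initial algebra of `R`: the `𝕜`-span of the initial terms of the elements of `R`. -/
noncomputable def initialAlgebra {σ 𝕜 : Type*} [Field 𝕜] (m : MonomialOrder σ)
    (R : Subalgebra 𝕜 (MvPolynomial σ 𝕜)) : Submodule 𝕜 (MvPolynomial σ 𝕜) :=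
  Submodule.span 𝕜 (m.leadingTerm '' (R : Set (MvPolynomial σ 𝕜)))

/-- `F` is a Khovanskii (SAGBI) basis of `R` with respect to the monomial order `m`: it lies in
`R`, and the initial terms of its elements generate the initial algebra of `R`. -/
def IsKhovanskiiBasis {σ 𝕜 : Type*} [Field 𝕜] (m : MonomialOrder σ)
    (F : Set (MvPolynomial σ 𝕜)) (R : Subalgebra 𝕜 (MvPolynomial σ 𝕜)) : Prop :=
  F ⊆ R ∧
    Subalgebra.toSubmodule (Algebra.adjoin 𝕜 (m.leadingTerm '' F)) = initialAlgebra m R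

/-- The polynomial `x_α x_β - x_{α ∧ β} x_{α ∨ β}`. -/
noncomputable def hibiPoly (𝕜 : Type*) [Field 𝕜] {L : Type*} [Lattice L] (α β : L) :
    MvPolynomial L 𝕜 :=
  X α * X β - X (α ⊓ β) * X (α ⊔ β)

/-- The set of the polynomials `x_α x_β - x_{α ∧ β} x_{α ∨ β}` with `α`, `β` incomparable. -/
def hibiSet (𝕜 : Type*) [Field 𝕜] (L : Type*) [Lattice L] : Set (MvPolynomial L 𝕜) :=
  {f | ∃ α β : L, ¬ α ≤ β ∧ ¬ β ≤ α ∧ f = hibiPoly 𝕜 α β}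

/-- The subalgebra generated by `hibiSet 𝕜 L`. -/
noncomputable def hibiAlgebra (𝕜 : Type*) [Field 𝕜] (L : Type*) [Lattice L] :
    Subalgebra 𝕜 (MvPolynomial L 𝕜) :=
  Algebra.adjoin 𝕜 (hibiSet 𝕜 L)

/-- The initial term of `x_α x_β - x_{α ∧ β} x_{α ∨ β}` is `x_α x_β` for all incomparable
`α`, `β`. -/
def IsCompatible (𝕜 : Type*) [Field 𝕜] {L : Type*} [Lattice L] (m : MonomialOrder L) : Prop :=
  ∀ α β : L, ¬ α ≤ β → ¬ β ≤ α → m.leadingTerm (hibiPoly 𝕜 α β) = X α * X β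

end HibiKhovanskii

open HibiKhovanskii

universe u v

namespace HibiKhovanskii

open MvPolynomial

/-! ### Products of Hibi polynomials and their degrees -/

/-! The pivot is the condition that $L=L(P)$ has no three pairwise incomparable elements. For ideals
this amounts to (2): see `widthLeTwo_of_free` and `free_of_widthLeTwo`.

Suppose the width is at most two. $\mathcal R$ is spanned by the products of the $f_{\alpha,\beta}$
over multisets $E$ of incomparable pairs, and such a product has initial monomial `edgeDeg E`. Only
cancellation of initial terms could produce new initial monomials, so it suffices that two products
with the same initial monomial differ by a combination of products with smaller ones
(`edgeProd_sub_mem_lowSpan`). A single quadratic identity (`hibiPoly_mul_sub_mul`) uncrosses pairs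
modulo such terms. Both multisets can thus be made to contain the same minimal pair, which is split
off, and well-founded induction along the monomial order finishes.

Conversely, a 3-antichain or a $2+2$ in $P$ yields a cube or a grid in $L$. There the same four
variables can be paired in two ways, and the difference $g\ne0$ of the two products lives on an
interval and has every monomial divisible by the variable of an end point. An end point is
comparable to the whole interval, so the initial monomial of $g$ is not a product of incomparable
pairs (`not_isKhovanskiiBasis`). A compatible order exists, by weighting $x_I$ with a strictly
concave function of $|I|$, so "every" implies "some".

A snake poset without its top and bottom is covered by two chains, hence has width at most two. In
the other direction, irreducibility gives at least two ideals of every size strictly between $0$ and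
$|P|$, the width gives at most two, and their join is one element larger. The only freedom at each
size is which of the two lies below the new ideal that is not their join; this choice is the next
letter of the word. -/

/-- Among any three elements, two are comparable. -/
def WidthLeTwo (L : Type*) [LE L] : Prop :=
  ∀ a b c : L, ¬ (IncompRel (· ≤ ·) a b ∧ IncompRel (· ≤ ·) b c ∧ IncompRel (· ≤ ·) a c)

/-- The exponent of the monomial `x_a x_b`. -/
noncomputable def pairDeg {L : Type*} (a b : L) : L →₀ ℕ :=
  Finsupp.single a 1 + Finsupp.single b 1

theorem pairDeg_comm {L : Type*} (a b : L) : pairDeg a b = pairDeg b a := add_comm _ _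

theorem X_mul_X_eq_monomial {𝕜 L : Type*} [Field 𝕜] (a b : L) :
    (X a * X b : MvPolynomial L 𝕜) = monomial (pairDeg a b) 1 := by
  simp [X, pairDeg, monomial_mul]

/-- The exponent of the product of the monomials `x_a x_b` for `(a, b)` in `E`. -/
noncomputable def edgeDeg {L : Type*} (E : Multiset (L × L)) : L →₀ ℕ :=
  (E.map fun e => pairDeg e.1 e.2).sum

/-- The product of the Hibi polynomials of the pairs in `E`. -/
noncomputable def edgeProd (𝕜 : Type*) [Field 𝕜] {L : Type*} [Lattice L] (E : Multiset (L × L)) :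
    MvPolynomial L 𝕜 :=
  (E.map fun e => hibiPoly 𝕜 e.1 e.2).prod

/-- All pairs in `E` are incomparable. -/
def AllIncomp {L : Type*} [LE L] (E : Multiset (L × L)) : Prop :=
  ∀ e ∈ E, IncompRel (· ≤ ·) e.1 e.2

section Basic

variable {L : Type*}

@[simp] theorem edgeDeg_zero : edgeDeg (0 : Multiset (L × L)) = 0 := rfl

@[simp] theorem edgeDeg_cons (e : L × L) (E : Multiset (L × L)) :
    edgeDeg (e ::ₘ E) = pairDeg e.1 e.2 + edgeDeg E := by
  simp [edgeDeg]

@[simp] theorem edgeDeg_add (E E' : Multiset (L × L)) :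
    edgeDeg (E + E') = edgeDeg E + edgeDeg E' := by
  simp [edgeDeg]

theorem edgeDeg_eq_zero_iff {E : Multiset (L × L)} : edgeDeg E = 0 ↔ E = 0 := by
  refine ⟨fun h => ?_, fun h => by simp [h]⟩
  induction E using Multiset.induction_on with
  | empty => rfl
  | cons e E _ =>
    have := DFunLike.congr_fun h e.1
    simp [pairDeg] at this

theorem mem_of_edgeDeg_ne_zero {E : Multiset (L × L)} {v : L} (h : edgeDeg E v ≠ 0) :
    ∃ e ∈ E, v = e.1 ∨ v = e.2 := by
  induction E using Multiset.induction_on with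
  | empty => simp at h
  | cons e E ih =>
    by_cases hE : edgeDeg E v = 0
    · refine ⟨e, Multiset.mem_cons_self _ _, ?_⟩
      by_contra! hne
      simp [hE, pairDeg, hne.1.symm, hne.2.symm] at h
    · obtain ⟨e', he', h'⟩ := ih hE
      exact ⟨e', Multiset.mem_cons_of_mem he', h'⟩

theorem edgeDeg_ne_zero_of_mem {E : Multiset (L × L)} {e : L × L} (he : e ∈ E) :
    edgeDeg E e.1 ≠ 0 ∧ edgeDeg E e.2 ≠ 0 := by
  obtain ⟨E', rfl⟩ := Multiset.exists_cons_of_mem he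
  simp [pairDeg]

variable [LE L]

theorem AllIncomp.zero : AllIncomp (0 : Multiset (L × L)) := by simp [AllIncomp]

theorem allIncomp_cons {e : L × L} {E : Multiset (L × L)} :
    AllIncomp (e ::ₘ E) ↔ IncompRel (· ≤ ·) e.1 e.2 ∧ AllIncomp E := by
  simp [AllIncomp]

theorem AllIncomp.add {E E' : Multiset (L × L)} (h : AllIncomp E) (h' : AllIncomp E') :
    AllIncomp (E + E') := by
  intro e he
  rcases Multiset.mem_add.mp he with he | he
  exacts [h e he, h' e he]

end Basic

section Lattice

variable {𝕜 L : Type*} [Field 𝕜] [Lattice L]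

theorem hibiPoly_comm (a b : L) : hibiPoly 𝕜 a b = hibiPoly 𝕜 b a := by
  simp [hibiPoly, inf_comm, sup_comm, mul_comm]

@[simp] theorem edgeProd_zero : edgeProd 𝕜 (0 : Multiset (L × L)) = 1 := rfl

@[simp] theorem edgeProd_cons (e : L × L) (E : Multiset (L × L)) :
    edgeProd 𝕜 (e ::ₘ E) = hibiPoly 𝕜 e.1 e.2 * edgeProd 𝕜 E := by
  simp [edgeProd]

@[simp] theorem edgeProd_add (E E' : Multiset (L × L)) :
    edgeProd 𝕜 (E + E') = edgeProd 𝕜 E * edgeProd 𝕜 E' := by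
  simp [edgeProd]

theorem mem_hibiAlgebra_iff_mem_span {f : MvPolynomial L 𝕜} :
    f ∈ hibiAlgebra 𝕜 L ↔ f ∈ Submodule.span 𝕜 (edgeProd 𝕜 '' {E | AllIncomp E}) := by
  constructor
  · intro hf
    unfold hibiAlgebra at hf
    induction hf using Algebra.adjoin_induction with
    | mem x hx =>
      obtain ⟨a, b, h1, h2, rfl⟩ := hx
      refine Submodule.subset_span ⟨{(a, b)}, ?_, by simp [edgeProd]⟩
      simp [AllIncomp, IncompRel, h1, h2]
    | algebraMap r =>
      rw [Algebra.algebraMap_eq_smul_one]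
      exact Submodule.smul_mem _ _ (Submodule.subset_span ⟨0, AllIncomp.zero, rfl⟩)
    | add x y _ _ hx hy => exact add_mem hx hy
    | mul x y _ _ hx hy =>
      have := Submodule.mul_mem_mul hx hy
      rw [Submodule.span_mul_span] at this
      refine Submodule.span_mono ?_ this
      rintro _ ⟨_, ⟨E, hE, rfl⟩, _, ⟨E', hE', rfl⟩, rfl⟩
      exact ⟨E + E', AllIncomp.add hE hE', by simp⟩
  · intro hf
    refine (Submodule.span_le (p := Subalgebra.toSubmodule (hibiAlgebra 𝕜 L))).mpr ?_ hf
    rintro _ ⟨E, hE, rfl⟩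
    refine Subalgebra.multiset_prod_mem _ fun x hx => ?_
    obtain ⟨e, he, rfl⟩ := Multiset.mem_map.mp hx
    exact Algebra.subset_adjoin ⟨e.1, e.2, (hE e he).1, (hE e he).2, rfl⟩

variable {m : MonomialOrder L}

theorem IsCompatible.leadingTerm_eq (hm : IsCompatible 𝕜 m) {a b : L}
    (h : IncompRel (· ≤ ·) a b) : m.leadingTerm (hibiPoly 𝕜 a b) = monomial (pairDeg a b) 1 := by
  rw [hm a b h.1 h.2, X_mul_X_eq_monomial]

theorem IsCompatible.degree_monic (hm : IsCompatible 𝕜 m) {a b : L}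
    (h : IncompRel (· ≤ ·) a b) :
    m.degree (hibiPoly 𝕜 a b) = pairDeg a b ∧ m.Monic (hibiPoly 𝕜 a b) := by
  have h1 := hm.leadingTerm_eq h
  have h2 := congrArg m.degree h1
  have h3 := congrArg m.leadingCoeff h1
  classical
  simp only [MonomialOrder.degree_leadingTerm, MonomialOrder.leadingCoeff_leadingTerm,
    MonomialOrder.leadingCoeff_monomial, MonomialOrder.degree_monomial, one_ne_zero,
    if_false] at h2 h3
  exact ⟨h2, h3⟩

theorem IsCompatible.degree_edgeProd (hm : IsCompatible 𝕜 m) {E : Multiset (L × L)}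
    (hE : AllIncomp E) :
    m.degree (edgeProd 𝕜 E) = edgeDeg E ∧ m.Monic (edgeProd 𝕜 E) := by
  induction E using Multiset.induction_on with
  | empty => simp
  | cons e E ih =>
    rw [allIncomp_cons] at hE
    obtain ⟨h1, h2⟩ := ih hE.2
    obtain ⟨h3, h4⟩ := hm.degree_monic hE.1
    rw [edgeProd_cons, edgeDeg_cons, MonomialOrder.degree_mul h4.ne_zero h2.ne_zero, h1, h3]
    exact ⟨rfl, h4.mul h2⟩

/-- The leading monomial of an incomparable pair is larger than the one of its meet and join. -/
theorem IsCompatible.inf_sup_lt (hm : IsCompatible 𝕜 m) {a b : L}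
    (h : IncompRel (· ≤ ·) a b) :
    m.toSyn (pairDeg (a ⊓ b) (a ⊔ b)) < m.toSyn (pairDeg a b) := by
  classical
  obtain ⟨h1, -⟩ := hm.degree_monic h
  have hne : pairDeg (a ⊓ b) (a ⊔ b) ≠ pairDeg a b := by
    intro he
    have := DFunLike.congr_fun he a
    have ha : a ⊓ b ≠ a := fun h' => h.1 (inf_eq_left.mp h')
    have ha' : a ⊔ b ≠ a := fun h' => h.2 (sup_eq_left.mp h')
    simp [pairDeg, ha, ha'] at this
    omega
  refine lt_of_le_of_ne ?_ (fun h' => hne (m.toSyn.injective h'))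
  rw [← h1]
  apply m.le_degree
  rw [mem_support_iff, hibiPoly, X_mul_X_eq_monomial, X_mul_X_eq_monomial, coeff_sub,
    coeff_monomial, coeff_monomial, if_neg hne.symm, if_pos rfl]
  simp

variable (𝕜 m) in
/-- The span of the products of Hibi polynomials of degree less than `s`. -/
noncomputable def lowSpan (s : m.syn) : Submodule 𝕜 (MvPolynomial L 𝕜) :=
  Submodule.span 𝕜 (edgeProd 𝕜 '' {E | AllIncomp E ∧ m.toSyn (edgeDeg E) < s})

theorem edgeProd_mem_lowSpan {s : m.syn} {E : Multiset (L × L)} (hE : AllIncomp E)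
    (h : m.toSyn (edgeDeg E) < s) : edgeProd 𝕜 E ∈ lowSpan 𝕜 m s :=
  Submodule.subset_span ⟨E, ⟨hE, h⟩, rfl⟩

theorem mul_mem_lowSpan {s : m.syn} {E : Multiset (L × L)} (hE : AllIncomp E)
    {f : MvPolynomial L 𝕜} (hf : f ∈ lowSpan 𝕜 m s) :
    edgeProd 𝕜 E * f ∈ lowSpan 𝕜 m (m.toSyn (edgeDeg E) + s) := by
  unfold lowSpan at hf
  induction hf using Submodule.span_induction with
  | mem x hx =>
    obtain ⟨E', ⟨h1, h2⟩, rfl⟩ := hx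
    rw [← edgeProd_add]
    apply edgeProd_mem_lowSpan (hE.add h1)
    rw [edgeDeg_add, map_add]
    exact add_lt_add_right h2 _
  | zero => simp
  | add x y _ _ hx hy => rw [mul_add]; exact add_mem hx hy
  | smul c x _ hx => rw [mul_smul_comm]; exact Submodule.smul_mem _ _ hx

theorem IsCompatible.lt_of_mem_support (hm : IsCompatible 𝕜 m) {s : m.syn}
    {f : MvPolynomial L 𝕜} (hf : f ∈ lowSpan 𝕜 m s) {d : L →₀ ℕ} (hd : d ∈ f.support) :
    m.toSyn d < s := by
  by_contra hlt
  rw [mem_support_iff] at hd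
  refine hd ?_
  unfold lowSpan at hf
  clear hd
  induction hf using Submodule.span_induction with
  | mem x hx =>
    obtain ⟨E, ⟨h1, h2⟩, rfl⟩ := hx
    apply m.coeff_eq_zero_of_lt
    rw [(hm.degree_edgeProd h1).1]
    exact h2.trans_le (not_lt.mp hlt)
  | zero => simp
  | add x y _ _ hx hy => simp [hx, hy]
  | smul c x _ hx => simp [hx]

end Lattice

/-! ### Straightening in distributive lattices of width two -/

section Straightening

variable {𝕜 L : Type*} [Field 𝕜] [DistribLattice L]

/-- Distributivity and the hypotheses force $a'\wedge b=a\wedge b$, $a\vee b'=a\vee b$, $a'\wedge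
b'=a\wedge b'$ and $a'\vee b'=a'\vee b$. After these coincidences the claim is a polynomial
identity. -/
theorem hibiPoly_mul_sub_mul {a a' b b' : L} (haa : a ≤ a') (hbb : b ≤ b')
    (h1 : a' ⊓ b ≤ a) (h2 : b' ≤ a ⊔ b) :
    hibiPoly 𝕜 a b * hibiPoly 𝕜 a' b' - hibiPoly 𝕜 a b' * hibiPoly 𝕜 a' b =
      hibiPoly 𝕜 a' (a ⊔ b) * hibiPoly 𝕜 b (a ⊓ b') := by
  have e1 : a' ⊓ b = a ⊓ b :=
    le_antisymm (le_inf h1 inf_le_right) (inf_le_inf_right _ haa)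
  have e2 : a ⊔ b' = a ⊔ b :=
    le_antisymm (sup_le le_sup_left h2) (sup_le_sup_left hbb _)
  have e3 : a' ⊓ (a ⊔ b) = a := by
    rw [inf_sup_left, inf_eq_right.mpr haa, e1, sup_inf_self]
  have e4 : a' ⊓ b' = a ⊓ b' := by
    refine le_antisymm (le_inf ?_ inf_le_right) (inf_le_inf_right _ haa)
    calc a' ⊓ b' ≤ a' ⊓ (a ⊔ b) := inf_le_inf_left _ h2
      _ = a := e3
  have e5 : a' ⊔ b' = a' ⊔ b := by
    refine le_antisymm (sup_le le_sup_left ?_) (sup_le_sup_left hbb _)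
    exact h2.trans (sup_le_sup_right haa _)
  have e6 : a' ⊔ (a ⊔ b) = a' ⊔ b := by
    rw [← sup_assoc, sup_eq_left.mpr haa]
  have e7 : b ⊔ a ⊓ b' = b' := by
    rw [sup_inf_left, sup_eq_right.mpr hbb, sup_comm, inf_eq_right.mpr h2]
  have e8 : b ⊓ (a ⊓ b') = a ⊓ b := by
    rw [inf_left_comm, inf_eq_left.mpr hbb]
  simp only [hibiPoly, e1, e2, e3, e4, e5, e6, e7, e8]
  ring

variable {m : MonomialOrder L}

theorem swap_mem_lowSpan_aux (hm : IsCompatible 𝕜 m) {a a' b b' : L}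
    (haa : a ≤ a') (hbb : b ≤ b') (hab' : IncompRel (· ≤ ·) a b')
    (ha'b : IncompRel (· ≤ ·) a' b) (h1 : a' ⊓ b ≤ a) (h2 : b' ≤ a ⊔ b)
    (hna : a ≠ a') (hnb : b ≠ b') :
    hibiPoly 𝕜 a b' * hibiPoly 𝕜 a' b - hibiPoly 𝕜 a b * hibiPoly 𝕜 a' b' ∈
      lowSpan 𝕜 m (m.toSyn (pairDeg a b' + pairDeg a' b)) := by
  rw [← neg_sub, hibiPoly_mul_sub_mul haa hbb h1 h2]
  refine neg_mem ?_
  have e3 : a' ⊓ (a ⊔ b) = a := by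
    refine le_antisymm ?_ (le_inf haa le_sup_left)
    rw [inf_sup_left, inf_eq_right.mpr haa]
    exact sup_le le_rfl h1
  have e7 : b ⊔ a ⊓ b' = b' := by
    rw [sup_inf_left, sup_eq_right.mpr hbb, sup_comm, inf_eq_right.mpr h2]
  have i1 : IncompRel (· ≤ ·) a' (a ⊔ b) := by
    refine ⟨fun h => hna ?_, fun h => ha'b.2 (le_sup_right.trans h)⟩
    rw [inf_eq_left.mpr h] at e3
    exact e3.symm
  have i2 : IncompRel (· ≤ ·) b (a ⊓ b') := by
    refine ⟨fun h => ha'b.2 ((h.trans inf_le_left).trans haa), fun h => hnb ?_⟩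
    rw [sup_eq_left.mpr h] at e7
    exact e7
  have hprod : hibiPoly 𝕜 a' (a ⊔ b) * hibiPoly 𝕜 b (a ⊓ b') =
      edgeProd 𝕜 ((a', a ⊔ b) ::ₘ (b, a ⊓ b') ::ₘ 0) := by
    simp only [edgeProd_cons, edgeProd_zero, mul_one]
  rw [hprod]
  apply edgeProd_mem_lowSpan
  · exact allIncomp_cons.mpr ⟨i1, allIncomp_cons.mpr ⟨i2, AllIncomp.zero⟩⟩
  -- As $a\vee b=a\vee b'$, the new monomial arises from the old one by replacing $x_ax_{b'}$ with
  -- $x_{a\wedge b'}x_{a\vee b'}$, which compatibility makes smaller.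
  · have e2 : a ⊔ b' = a ⊔ b :=
      le_antisymm (sup_le le_sup_left h2) (sup_le_sup_left hbb _)
    have hlt := hm.inf_sup_lt hab'
    rw [e2] at hlt
    have hd : edgeDeg ((a', a ⊔ b) ::ₘ (b, a ⊓ b') ::ₘ 0) =
        pairDeg (a ⊓ b') (a ⊔ b) + pairDeg a' b := by
      simp only [edgeDeg_cons, edgeDeg_zero, pairDeg]
      abel
    rw [hd, map_add, map_add]
    exact add_lt_add_left hlt _

/-- Uncrossing two pairs changes the product of their Hibi polynomials by lower terms. -/
theorem swap_mem_lowSpan (hm : IsCompatible 𝕜 m) (hL : WidthLeTwo L) {a a' b b' : L}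
    (haa : a ≤ a') (hbb : b ≤ b') (hab : IncompRel (· ≤ ·) a b)
    (hab' : IncompRel (· ≤ ·) a b') (ha'b : IncompRel (· ≤ ·) a' b) :
    hibiPoly 𝕜 a b' * hibiPoly 𝕜 a' b - hibiPoly 𝕜 a b * hibiPoly 𝕜 a' b' ∈
      lowSpan 𝕜 m (m.toSyn (pairDeg a b' + pairDeg a' b)) := by
  by_cases hna : a = a'
  · subst hna; rw [mul_comm, sub_self]; exact zero_mem _
  by_cases hnb : b = b'
  · subst hnb; rw [sub_self]; exact zero_mem _
  have ha'b' : IncompRel (· ≤ ·) a' b' :=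
    ⟨fun h => hab'.1 (haa.trans h), fun h => ha'b.2 (hbb.trans h)⟩
  -- If this failed, $a$, $b$, $a'\wedge b'$ would be an antichain; `k2` is dual. Distributivity
  -- gives `k3` and `k4`, so that exactly two mirror-image cases of `swap_mem_lowSpan_aux` remain.
  have k1 : a' ⊓ b ≤ a ∨ a ⊓ b' ≤ b := by
    by_contra! h
    refine hL a b (a' ⊓ b') ⟨hab, ⟨fun h' => ?_, fun h' => ?_⟩, ⟨fun h' => ?_, fun h' => ?_⟩⟩
    · exact ha'b.2 (h'.trans inf_le_left)
    · exact h.2 ((inf_le_inf_right _ haa).trans h')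
    · exact hab'.1 (h'.trans inf_le_right)
    · exact h.1 ((inf_le_inf_left _ hbb).trans h')
  have k2 : a' ≤ a ⊔ b ∨ b' ≤ a ⊔ b := by
    by_contra! h
    refine hL a' b' (a ⊔ b) ⟨ha'b', ⟨h.2, fun h' => ?_⟩, ⟨h.1, fun h' => ?_⟩⟩
    · exact hab'.1 (le_sup_left.trans h')
    · exact ha'b.2 (le_sup_right.trans h')
  have k3 : ¬ (a' ⊓ b ≤ a ∧ a' ≤ a ⊔ b) := by
    rintro ⟨h, h'⟩
    refine hna (le_antisymm haa ?_)
    rw [← inf_eq_left.mpr h', inf_sup_left, inf_eq_right.mpr haa]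
    exact sup_le le_rfl h
  have k4 : ¬ (a ⊓ b' ≤ b ∧ b' ≤ a ⊔ b) := by
    rintro ⟨h, h'⟩
    refine hnb (le_antisymm hbb ?_)
    rw [← inf_eq_left.mpr h', inf_sup_left, inf_eq_right.mpr hbb, inf_comm b' a]
    exact sup_le h le_rfl
  by_cases h1 : a' ⊓ b ≤ a
  · exact swap_mem_lowSpan_aux hm haa hbb hab' ha'b h1 (by tauto) hna hnb
  · have := swap_mem_lowSpan_aux (𝕜 := 𝕜) hm hbb haa ha'b.symm hab'.symm
      (by rw [inf_comm]; tauto) (by rw [sup_comm]; tauto) hnb hna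
    rw [hibiPoly_comm b a', hibiPoly_comm b' a, hibiPoly_comm b a, hibiPoly_comm b' a',
      pairDeg_comm b a', pairDeg_comm b' a, mul_comm (hibiPoly 𝕜 a' b), add_comm] at this
    exact this

/-- An element dividing the monomial of `E` lies in a pair of `E`, which we may split off. -/
theorem exists_cons_of_edgeDeg_ne_zero {E : Multiset (L × L)} (hE : AllIncomp E) {v : L}
    (hv : edgeDeg E v ≠ 0) :
    ∃ (x : L) (E' : Multiset (L × L)), AllIncomp ((v, x) ::ₘ E') ∧
      edgeDeg E = edgeDeg ((v, x) ::ₘ E') ∧ edgeProd 𝕜 E = edgeProd 𝕜 ((v, x) ::ₘ E') := by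
  obtain ⟨e, he, h⟩ := mem_of_edgeDeg_ne_zero hv
  obtain ⟨E', rfl⟩ := Multiset.exists_cons_of_mem he
  rw [allIncomp_cons] at hE
  rcases h with rfl | rfl
  · exact ⟨e.2, E', allIncomp_cons.mpr hE, rfl, rfl⟩
  · refine ⟨e.1, E', allIncomp_cons.mpr ⟨hE.1.symm, hE.2⟩, ?_, ?_⟩
    · simp [pairDeg_comm e.2]
    · simp [hibiPoly_comm e.2]

/-- Take $a$ minimal in the support and $b$ minimal among the elements not above $a$; an element
above neither would complete a 3-antichain. The pair depends only on `edgeDeg E`, so it serves every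
multiset with that exponent. -/
theorem exists_minimal_pair (hL : WidthLeTwo L) {E : Multiset (L × L)} (hE : AllIncomp E)
    (hne : E ≠ 0) :
    ∃ a b : L, edgeDeg E a ≠ 0 ∧ edgeDeg E b ≠ 0 ∧ IncompRel (· ≤ ·) a b ∧
      ∀ v, edgeDeg E v ≠ 0 → a ≤ v ∨ b ≤ v := by
  classical
  have hs : (edgeDeg E).support.Nonempty := by
    rw [Finsupp.support_nonempty_iff, Ne, edgeDeg_eq_zero_iff]
    exact hne
  obtain ⟨a, ha⟩ := (edgeDeg E).support.exists_minimal hs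
  have ha0 := Finsupp.mem_support_iff.mp ha.1
  have hs' : ((edgeDeg E).support.filter fun v => ¬ a ≤ v).Nonempty := by
    obtain ⟨e, he, h⟩ := mem_of_edgeDeg_ne_zero ha0
    have := edgeDeg_ne_zero_of_mem he
    rcases h with rfl | rfl
    · exact ⟨e.2, by simp [this.2, (hE e he).1]⟩
    · exact ⟨e.1, by simp [this.1, (hE e he).2]⟩
  obtain ⟨b, hb⟩ := Finset.exists_minimal hs'
  have hbm := Finset.mem_filter.mp hb.1
  have key : ∀ v, edgeDeg E v ≠ 0 → ¬ a ≤ v → IncompRel (· ≤ ·) a v := fun v hv hav =>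
    ⟨hav, fun h => hav (ha.2 (Finsupp.mem_support_iff.mpr hv) h)⟩
  refine ⟨a, b, ha0, Finsupp.mem_support_iff.mp hbm.1,
    key b (Finsupp.mem_support_iff.mp hbm.1) hbm.2, fun v hv => ?_⟩
  by_contra! h
  refine hL a b v ⟨key b (Finsupp.mem_support_iff.mp hbm.1) hbm.2, ⟨h.2, fun h' => ?_⟩,
    key v hv h.1⟩
  exact h.2 (hb.2 (Finset.mem_filter.mpr ⟨Finsupp.mem_support_iff.mpr hv, h.1⟩) h')

/-- If $a$ is paired with $x\ne b$ and $b$ with $y$, then incomparability and minimality give $b\le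
x$ and $a\le y$, so the pairs uncross to $(a,b)$ and $(y,x)$. -/
theorem exists_cons_sub_mem_lowSpan (hm : IsCompatible 𝕜 m) (hL : WidthLeTwo L)
    {E : Multiset (L × L)} (hE : AllIncomp E) {a b : L} (ha : edgeDeg E a ≠ 0)
    (hb : edgeDeg E b ≠ 0) (hab : IncompRel (· ≤ ·) a b)
    (hmin : ∀ v, edgeDeg E v ≠ 0 → a ≤ v ∨ b ≤ v) :
    ∃ E' : Multiset (L × L), AllIncomp ((a, b) ::ₘ E') ∧
      edgeDeg ((a, b) ::ₘ E') = edgeDeg E ∧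
      edgeProd 𝕜 E - edgeProd 𝕜 ((a, b) ::ₘ E') ∈ lowSpan 𝕜 m (m.toSyn (edgeDeg E)) := by
  obtain ⟨x, E₁, hE₁, hd₁, hp₁⟩ := exists_cons_of_edgeDeg_ne_zero (𝕜 := 𝕜) hE ha
  rw [allIncomp_cons] at hE₁
  rw [hd₁] at hb hmin ⊢
  rw [hp₁]
  by_cases hxb : x = b
  · subst hxb
    exact ⟨E₁, allIncomp_cons.mpr hE₁, rfl, by rw [sub_self]; exact zero_mem _⟩
  have hb' : edgeDeg E₁ b ≠ 0 := by
    intro h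
    have hne : a ≠ b := fun h => hab.1 h.le
    simp [pairDeg, h, hne, hxb] at hb
  obtain ⟨y, E₂, hE₂, hd₂, hp₂⟩ := exists_cons_of_edgeDeg_ne_zero (𝕜 := 𝕜) hE₁.2 hb'
  rw [allIncomp_cons] at hE₂
  have hbx : b ≤ x := (hmin x (by simp [pairDeg])).resolve_left hE₁.1.1
  have hay : a ≤ y := by
    refine (hmin y ?_).resolve_right hE₂.1.1
    simp [hd₂, pairDeg]
  refine ⟨(y, x) ::ₘ E₂, ?_, ?_, ?_⟩
  · refine allIncomp_cons.mpr ⟨hab, allIncomp_cons.mpr ⟨⟨fun h => ?_, fun h => ?_⟩, hE₂.2⟩⟩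
    · exact hE₁.1.1 (hay.trans h)
    · exact hE₂.1.1 (hbx.trans h)
  · simp only [edgeDeg_cons, hd₂, pairDeg]
    abel
  · have h := mul_mem_lowSpan hE₂.2
      (swap_mem_lowSpan (𝕜 := 𝕜) hm hL hay hbx hab hE₁.1 hE₂.1.symm)
    have e1 : edgeProd 𝕜 ((a, x) ::ₘ E₁) - edgeProd 𝕜 ((a, b) ::ₘ (y, x) ::ₘ E₂) =
        edgeProd 𝕜 E₂ * (hibiPoly 𝕜 a x * hibiPoly 𝕜 y b -
          hibiPoly 𝕜 a b * hibiPoly 𝕜 y x) := by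
      simp only [edgeProd_cons, hp₂, hibiPoly_comm b y]
      ring
    have e2 : edgeDeg ((a, x) ::ₘ E₁) = edgeDeg E₂ + (pairDeg a x + pairDeg y b) := by
      simp only [edgeDeg_cons, hd₂, pairDeg]
      abel
    rw [e1, e2, map_add]
    exact h

theorem edgeProd_sub_mem_lowSpan (hm : IsCompatible 𝕜 m) (hL : WidthLeTwo L)
    {E E' : Multiset (L × L)} (hE : AllIncomp E) (hE' : AllIncomp E')
    (h : edgeDeg E = edgeDeg E') :
    edgeProd 𝕜 E - edgeProd 𝕜 E' ∈ lowSpan 𝕜 m (m.toSyn (edgeDeg E)) := by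
  induction hs : m.toSyn (edgeDeg E) using WellFoundedLT.induction generalizing E E' with
  | ind s ih =>
  subst hs
  by_cases h0 : E = 0
  · subst h0
    rw [edgeDeg_zero, eq_comm, edgeDeg_eq_zero_iff] at h
    rw [h, sub_self]
    exact zero_mem _
  obtain ⟨a, b, ha, hb, hab, hmin⟩ := exists_minimal_pair hL hE h0
  obtain ⟨E₁, hE₁, hd₁, hp₁⟩ := exists_cons_sub_mem_lowSpan (𝕜 := 𝕜) hm hL hE ha hb hab hmin
  rw [h] at ha hb hmin
  obtain ⟨E₂, hE₂, hd₂, hp₂⟩ := exists_cons_sub_mem_lowSpan (𝕜 := 𝕜) hm hL hE' ha hb hab hmin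
  rw [← h] at hp₂
  have h12 : edgeDeg E₁ = edgeDeg E₂ := by
    have := hd₁.trans (h.trans hd₂.symm)
    simpa using this
  have hlt : m.toSyn (edgeDeg E₁) < m.toSyn (edgeDeg E) := by
    rw [← hd₁]
    apply m.toSyn_strictMono
    rw [edgeDeg_cons]
    refine lt_of_le_of_ne le_add_self fun h' => ?_
    have := DFunLike.congr_fun h' a
    simp [pairDeg] at this
  have key := ih _ hlt (allIncomp_cons.mp hE₁).2 (allIncomp_cons.mp hE₂).2 h12 rfl
  have key' := mul_mem_lowSpan (E := {(a, b)}) (by simpa [AllIncomp] using hab) key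
  have e : edgeProd 𝕜 E - edgeProd 𝕜 E' = (edgeProd 𝕜 E - edgeProd 𝕜 ((a, b) ::ₘ E₁)) -
      (edgeProd 𝕜 E' - edgeProd 𝕜 ((a, b) ::ₘ E₂)) +
      edgeProd 𝕜 {(a, b)} * (edgeProd 𝕜 E₁ - edgeProd 𝕜 E₂) := by
    rw [← Multiset.cons_zero]
    simp only [edgeProd_cons, edgeProd_zero]
    ring
  rw [e]
  refine add_mem (sub_mem hp₁ hp₂) ?_
  rw [← map_add, ← edgeDeg_add, Multiset.singleton_add, hd₁] at key'
  exact key'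

/-- Summands with equal leading exponent merge by `edgeProd_sub_mem_lowSpan`. The coefficient $c$
may vanish. The predicate `p` covers both uses: the whole algebra, and the part below a bound. -/
theorem exists_leading_decomposition (hm : IsCompatible 𝕜 m) (hL : WidthLeTwo L)
    {p : m.syn → Prop} {g : MvPolynomial L 𝕜}
    (hg : g ∈ Submodule.span 𝕜 (edgeProd 𝕜 '' {E | AllIncomp E ∧ p (m.toSyn (edgeDeg E))})) :
    g = 0 ∨ ∃ E, AllIncomp E ∧ p (m.toSyn (edgeDeg E)) ∧
      ∃ c : 𝕜, ∃ h ∈ lowSpan 𝕜 m (m.toSyn (edgeDeg E)), g = c • edgeProd 𝕜 E + h := by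
  induction hg using Submodule.span_induction with
  | mem x hx =>
    obtain ⟨E, ⟨h1, h2⟩, rfl⟩ := hx
    exact .inr ⟨E, h1, h2, 1, 0, zero_mem _, by simp⟩
  | zero => exact .inl rfl
  | add x y _ _ hx hy =>
    rcases hx with rfl | ⟨E, hE, hp, c, h, hh, rfl⟩
    · simpa using hy
    rcases hy with rfl | ⟨E', hE', hp', c', h', hh', rfl⟩
    · exact .inr ⟨E, hE, hp, c, h, hh, by simp⟩
    right
    have mono : ∀ {t t' : m.syn}, t ≤ t' → lowSpan 𝕜 m t ≤ lowSpan 𝕜 m t' := fun htt =>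
      Submodule.span_mono (Set.image_mono fun E hE => ⟨hE.1, hE.2.trans_le htt⟩)
    rcases lt_trichotomy (m.toSyn (edgeDeg E)) (m.toSyn (edgeDeg E')) with htt | htt | htt
    · refine ⟨E', hE', hp', c', c • edgeProd 𝕜 E + h + h', ?_, by ring⟩
      exact add_mem (add_mem (Submodule.smul_mem _ _ (edgeProd_mem_lowSpan hE htt))
        (mono htt.le hh)) hh'
    · have hd := m.toSyn.injective htt
      refine ⟨E, hE, hp, c + c', -(c' • (edgeProd 𝕜 E - edgeProd 𝕜 E')) + h + h', ?_, ?_⟩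
      · refine add_mem (add_mem (neg_mem (Submodule.smul_mem _ _ ?_)) hh) (htt ▸ hh')
        exact edgeProd_sub_mem_lowSpan hm hL hE hE' hd
      · rw [add_smul, smul_sub]; ring
    · refine ⟨E, hE, hp, c, c' • edgeProd 𝕜 E' + h' + h, ?_, by ring⟩
      exact add_mem (add_mem (Submodule.smul_mem _ _ (edgeProd_mem_lowSpan hE' htt))
        (mono htt.le hh')) hh
  | smul c x _ hx =>
    rcases hx with rfl | ⟨E, hE, hp, c', h, hh, rfl⟩
    · simp
    · exact .inr ⟨E, hE, hp, c * c', c • h, Submodule.smul_mem _ _ hh,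
        by rw [smul_add, smul_smul]⟩

/-- If $c\ne0$, the leading term is $c$ times a product of initial terms of generators. If $c=0$,
the element is rewritten with a strictly smaller exponent, and the descent terminates. -/
theorem leadingTerm_mem_adjoin (hm : IsCompatible 𝕜 m) (hL : WidthLeTwo L)
    {E : Multiset (L × L)} (hE : AllIncomp E) (c : 𝕜) {h : MvPolynomial L 𝕜}
    (hh : h ∈ lowSpan 𝕜 m (m.toSyn (edgeDeg E))) :
    m.leadingTerm (c • edgeProd 𝕜 E + h) ∈
      Algebra.adjoin 𝕜 (m.leadingTerm '' hibiSet 𝕜 L) := by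
  induction hs : m.toSyn (edgeDeg E) using WellFoundedLT.induction generalizing E c h with
  | ind s ih =>
  subst hs
  by_cases hc : c = 0
  · rcases exists_leading_decomposition (p := fun t => t < m.toSyn (edgeDeg E)) hm hL hh with
      h0 | ⟨E', hE', hlt, c', h', hh', heq⟩
    · simp [hc, h0]
    · rw [hc, zero_smul, zero_add, heq]
      exact ih _ hlt hE' c' hh' rfl
  suffices hlt : m.leadingTerm (c • edgeProd 𝕜 E + h) = c • monomial (edgeDeg E) 1 by
    rw [hlt]
    refine Subalgebra.smul_mem _ ?_ c
    clear hlt hh ih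
    induction E using Multiset.induction_on with
    | empty => exact one_mem _
    | cons e E ihE =>
      rw [allIncomp_cons] at hE
      rw [edgeDeg_cons, ← mul_one (1 : 𝕜), ← monomial_mul]
      refine mul_mem (Algebra.subset_adjoin ⟨_, ⟨e.1, e.2, hE.1.1, hE.1.2, rfl⟩, ?_⟩) (ihE hE.2)
      exact hm.leadingTerm_eq hE.1
  obtain ⟨h1, h2⟩ := hm.degree_edgeProd hE
  have hdeg : m.degree (c • edgeProd 𝕜 E) = edgeDeg E := by
    rw [MonomialOrder.degree_smul_of_isRegular (IsRegular.of_ne_zero hc), h1]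
  have hcoeff : m.leadingCoeff (c • edgeProd 𝕜 E) = c := by
    rw [MonomialOrder.leadingCoeff, hdeg, coeff_smul, ← h1, h2.coeff_degree, smul_eq_mul, mul_one]
  by_cases hh0 : h = 0
  · rw [hh0, add_zero, MonomialOrder.leadingTerm, hdeg, hcoeff, smul_monomial, smul_eq_mul,
      mul_one]
  have hlt : m.toSyn (m.degree h) < m.toSyn (m.degree (c • edgeProd 𝕜 E)) := by
    rw [hdeg]
    exact hm.lt_of_mem_support hh (m.degree_mem_support hh0)
  rw [MonomialOrder.leadingTerm, MonomialOrder.degree_add_of_lt hlt,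
    MonomialOrder.leadingCoeff_add_of_lt hlt, hdeg, hcoeff, smul_monomial, smul_eq_mul, mul_one]

theorem isKhovanskiiBasis_of_widthLeTwo (hm : IsCompatible 𝕜 m) (hL : WidthLeTwo L) :
    IsKhovanskiiBasis m (hibiSet 𝕜 L) (hibiAlgebra 𝕜 L) := by
  refine ⟨Algebra.subset_adjoin, le_antisymm ?_ ?_⟩
  · rw [Algebra.adjoin_eq_span, Submodule.span_le]
    refine fun x hx => Submodule.subset_span ?_
    induction hx using Submonoid.closure_induction with
    | mem x hx => exact Set.image_mono Algebra.subset_adjoin hx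
    | one => exact ⟨1, one_mem _, by simpa using m.leadingTerm_C (1 : 𝕜)⟩
    | mul x y _ _ hx hy =>
      obtain ⟨f, hf, rfl⟩ := hx
      obtain ⟨g, hg, rfl⟩ := hy
      exact ⟨f * g, mul_mem hf hg, m.leadingTerm_mul f g⟩
  · refine Submodule.span_le.mpr ?_
    rintro _ ⟨g, hg, rfl⟩
    rw [SetLike.mem_coe, mem_hibiAlgebra_iff_mem_span] at hg
    rcases exists_leading_decomposition (m := m) (p := fun _ => True) hm hL (by simpa using hg)
      with h0 | ⟨E, hE, -, c, h, hh, rfl⟩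
    · simp [h0]
    · exact leadingTerm_mem_adjoin hm hL hE c hh

end Straightening

/-! ### Existence of compatible monomial orders -/

/-- The exponent `d` together with its weight. -/
noncomputable def weightHom {σ : Type*} (w : σ → ℕ) :
    (σ →₀ ℕ) →+ Lex (ℕ × Lex (σ →₀ ℕ)) where
  toFun d := toLex (Finsupp.weight w d, toLex d)
  map_zero' := by rw [map_zero]; rfl
  map_add' a b := by rw [map_add]; rfl

theorem weightHom_injective {σ : Type*} (w : σ → ℕ) : Function.Injective (weightHom w) :=
  fun a b h => by
    have := congrArg (fun x => ofLex (ofLex x).2) h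
    exact this

/-- For every weight there is a monomial order which compares exponents by their weights first. -/
theorem exists_monomialOrder_of_weight {σ : Type u} [Finite σ] (w : σ → ℕ) :
    ∃ m : MonomialOrder.{u, u} σ, ∀ a b : σ →₀ ℕ,
      Finsupp.weight w a < Finsupp.weight w b → m.toSyn a < m.toSyn b := by
  classical
  let : LinearOrder σ := linearOrderOfSTO WellOrderingRel
  -- Restricting to the range turns the injection into the equivalence that a monomial order
  -- requires; the order is inherited from the lexicographic product.
  let e : (σ →₀ ℕ) ≃+ AddMonoidHom.mrange (weightHom w) :=
    { Equiv.ofBijective (weightHom w).mrangeRestrict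
        ⟨fun _ _ h => weightHom_injective w (congrArg Subtype.val h),
          AddMonoidHom.mrangeRestrict_surjective _⟩ with
      map_add' := fun a b => (weightHom w).mrangeRestrict.map_add a b }
  refine ⟨{ syn := AddMonoidHom.mrange (weightHom w), toSyn := e, toSyn_monotone := ?_ }, ?_⟩
  · intro a b h
    change weightHom w a ≤ weightHom w b
    refine Prod.Lex.toLex_mono ⟨?_, Finsupp.toLex_monotone h⟩
    obtain ⟨c, rfl⟩ := exists_add_of_le h
    simp
  · intro a b h
    change weightHom w a < weightHom w b
    exact Prod.Lex.toLex_lt_toLex.mpr (Or.inl h)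

theorem isCompatible_of_lt {𝕜 L : Type*} [Field 𝕜] [Lattice L] {m : MonomialOrder L}
    (h : ∀ a b : L, IncompRel (· ≤ ·) a b →
      m.toSyn (pairDeg (a ⊓ b) (a ⊔ b)) < m.toSyn (pairDeg a b)) : IsCompatible 𝕜 m := by
  classical
  intro a b hab hba
  have hlt : m.toSyn (m.degree (X (a ⊓ b) * X (a ⊔ b) : MvPolynomial L 𝕜)) <
      m.toSyn (m.degree (X a * X b : MvPolynomial L 𝕜)) := by
    rw [X_mul_X_eq_monomial, X_mul_X_eq_monomial, m.degree_monomial, m.degree_monomial,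
      if_neg one_ne_zero, if_neg one_ne_zero]
    exact h a b ⟨hab, hba⟩
  rw [MonomialOrder.leadingTerm, hibiPoly, MonomialOrder.degree_sub_of_lt hlt,
    MonomialOrder.leadingCoeff_sub_of_lt hlt, X_mul_X_eq_monomial]
  simp [m.degree_monomial]

/-- Meet and join have the same total size as the two ideals but are further apart, so strict
convexity of squares makes the weight $|P|^2-|I|^2$ of their monomial smaller. -/
theorem exists_isCompatible (𝕜 : Type*) [Field 𝕜] (P : Type v) [PartialOrder P] [Finite P] :
    ∃ m : MonomialOrder.{v, v} (LowerSet P), IsCompatible 𝕜 m := by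
  obtain ⟨m, hm⟩ := exists_monomialOrder_of_weight
    (fun I : LowerSet P => Nat.card P ^ 2 - (I : Set P).ncard ^ 2)
  refine ⟨m, isCompatible_of_lt fun a b hab => hm _ _ ?_⟩
  -- This bound makes the natural-number subtraction in the weight exact.
  have hle : ∀ I : LowerSet P, (I : Set P).ncard ^ 2 ≤ Nat.card P ^ 2 := fun I =>
    Nat.pow_le_pow_left (Set.ncard_le_card _) 2
  have h1 := hle a
  have h2 := hle b
  have h3 := hle (a ⊓ b)
  have h4 := hle (a ⊔ b)
  simp only [pairDeg, map_add, Finsupp.weight_single, smul_eq_mul, one_mul]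
  suffices (a : Set P).ncard ^ 2 + (b : Set P).ncard ^ 2 <
      ((a ⊓ b : LowerSet P) : Set P).ncard ^ 2 + ((a ⊔ b : LowerSet P) : Set P).ncard ^ 2 by
    omega
  have ha : ((a ⊓ b : LowerSet P) : Set P).ncard < (a : Set P).ncard :=
    Set.ncard_lt_ncard (LowerSet.coe_ssubset_coe.mpr (inf_lt_left.mpr hab.1))
  have hb : ((a ⊓ b : LowerSet P) : Set P).ncard < (b : Set P).ncard :=
    Set.ncard_lt_ncard (LowerSet.coe_ssubset_coe.mpr (inf_lt_right.mpr hab.2))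
  have hsum := Set.ncard_union_add_ncard_inter (a : Set P) (b : Set P)
  rw [← LowerSet.coe_sup, ← LowerSet.coe_inf] at hsum
  obtain ⟨x, hx⟩ := Nat.exists_eq_add_of_lt ha
  obtain ⟨y, hy⟩ := Nat.exists_eq_add_of_lt hb
  have hj : ((a ⊔ b : LowerSet P) : Set P).ncard =
      ((a ⊓ b : LowerSet P) : Set P).ncard + x + y + 2 := by omega
  rw [hj, hx, hy]
  nlinarith

/-! ### Forbidden subposets and antichains of ideals -/

section Forbidden

variable {P : Type*} [PartialOrder P]

theorem not_onePlusOnePlusOneFree_iff :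
    ¬ OnePlusOnePlusOneFree P ↔ ∃ p q r : P, IncompRel (· ≤ ·) p q ∧ IncompRel (· ≤ ·) q r ∧
      IncompRel (· ≤ ·) p r := by
  rw [OnePlusOnePlusOneFree, not_isEmpty_iff]
  constructor
  · rintro ⟨f⟩
    refine ⟨f (.inl 0), f (.inr (.inl 0)), f (.inr (.inr 0)), ?_, ?_, ?_⟩ <;>
      simp [IncompRel]
  · rintro ⟨p, q, r, hpq, hqr, hpr⟩
    refine ⟨OrderEmbedding.ofMapLEIff
      (Sum.elim (fun _ => p) (Sum.elim (fun _ => q) fun _ => r)) ?_⟩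
    rintro (a | a | a) (b | b | b) <;>
      simp [hpq.1, hpq.2, hqr.1, hqr.2, hpr.1, hpr.2, Subsingleton.elim a b]

theorem not_twoPlusTwoFree_iff :
    ¬ TwoPlusTwoFree P ↔ ∃ p p' q q' : P, p < p' ∧ q < q' ∧ ¬ p ≤ q' ∧ ¬ q ≤ p' := by
  rw [TwoPlusTwoFree, not_isEmpty_iff]
  constructor
  · rintro ⟨f⟩
    refine ⟨f (.inl 0), f (.inl 1), f (.inr 0), f (.inr 1), ?_, ?_, ?_, ?_⟩ <;> simp
  · rintro ⟨p, p', q, q', hp, hq, hpq, hqp⟩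
    have h1 : ¬ p ≤ q := fun h => hpq (h.trans hq.le)
    have h2 : ¬ p' ≤ q' := fun h => hpq (hp.le.trans h)
    have h3 : ¬ p' ≤ q := fun h => h1 (hp.le.trans h)
    have h4 : ¬ q ≤ p := fun h => hqp (h.trans hp.le)
    have h5 : ¬ q' ≤ p' := fun h => hqp (hq.le.trans h)
    have h6 : ¬ q' ≤ p := fun h => h4 (hq.le.trans h)
    refine ⟨OrderEmbedding.ofMapLEIff (Sum.elim ![p, p'] ![q, q']) ?_⟩
    rintro (a | a) (b | b) <;> fin_cases a <;> fin_cases b <;>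
      simp [hp.le, hp.not_ge, hq.le, hq.not_ge, hpq, hqp, h1, h2, h3, h4, h5, h6]

/-- The configuration of four ideal elements arising from an antichain of three ideals. -/
theorem exists_forbidden_of_notMem {I J K : LowerSet P} {x y z w : P}
    (hx : x ∈ I ∧ x ∈ J ∧ x ∉ K) (hy : y ∈ I ∧ y ∉ J ∧ y ∈ K)
    (hz : z ∉ I ∧ z ∈ J ∧ z ∉ K) (hw : w ∉ I ∧ w ∉ J ∧ w ∈ K) :
    ¬ TwoPlusTwoFree P ∨ ¬ OnePlusOnePlusOneFree P := by
  have key : ∀ {M : LowerSet P} {s t : P}, s ∉ M → t ∈ M → ¬ s ≤ t := fun hs ht hst =>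
    hs (LowerSet.lower _ hst ht)
  -- The memberships exclude every relation among the four elements except $x\le z$ and $y\le w$.
  by_cases hxz : x ≤ z
  · by_cases hyw : y ≤ w
    · left
      rw [not_twoPlusTwoFree_iff]
      refine ⟨x, z, y, w, lt_of_le_not_ge hxz (key hz.1 hx.1), lt_of_le_not_ge hyw
        (key hw.1 hy.1), key hx.2.2 hw.2.2, key hy.2.1 hz.2.1⟩
    · right
      rw [not_onePlusOnePlusOneFree_iff]
      exact ⟨y, z, w, ⟨key hy.2.1 hz.2.1, key hz.1 hy.1⟩, ⟨key hz.2.2 hw.2.2, key hw.2.1 hz.2.1⟩,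
        ⟨hyw, key hw.1 hy.1⟩⟩
  · right
    rw [not_onePlusOnePlusOneFree_iff]
    exact ⟨x, z, w, ⟨hxz, key hz.1 hx.1⟩, ⟨key hz.2.2 hw.2.2, key hw.2.1 hz.2.1⟩,
      ⟨key hx.2.2 hw.2.2, key hw.1 hx.1⟩⟩

/-- Count the ideals owning an element that lies in neither of the others. If all three do, these
elements form an antichain. If at most one does, elements in exactly two of the ideals form one. If
exactly two do, the four-element configuration of `exists_forbidden_of_notMem` appears. -/
theorem widthLeTwo_of_free (h2 : TwoPlusTwoFree P) (h1 : OnePlusOnePlusOneFree P) :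
    WidthLeTwo (LowerSet P) := by
  rintro I J K ⟨hIJ, hJK, hIK⟩
  have key : ∀ {M : LowerSet P} {s t : P}, s ∉ M → t ∈ M → ¬ s ≤ t := fun hs ht hst =>
    hs (LowerSet.lower _ hst ht)
  have no3 : ∀ {p q r : P}, IncompRel (· ≤ ·) p q → IncompRel (· ≤ ·) q r →
      IncompRel (· ≤ ·) p r → False := fun hpq hqr hpr =>
    not_onePlusOnePlusOneFree_iff.mpr ⟨_, _, _, hpq, hqr, hpr⟩ h1
  have no4 : ∀ {I J K : LowerSet P} {x y z w : P},
      (x ∈ I ∧ x ∈ J ∧ x ∉ K) → (y ∈ I ∧ y ∉ J ∧ y ∈ K) →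
      (z ∉ I ∧ z ∈ J ∧ z ∉ K) → (w ∉ I ∧ w ∉ J ∧ w ∈ K) → False := by
    intro I J K x y z w hx hy hz hw
    rcases exists_forbidden_of_notMem hx hy hz hw with h | h
    exacts [h h2, h h1]
  obtain ⟨a, ha, ha'⟩ := Set.not_subset.mp hIJ.1
  obtain ⟨b, hb, hb'⟩ := Set.not_subset.mp hIJ.2
  obtain ⟨c, hc, hc'⟩ := Set.not_subset.mp hJK.1
  obtain ⟨d, hd, hd'⟩ := Set.not_subset.mp hJK.2
  obtain ⟨e, he, he'⟩ := Set.not_subset.mp hIK.1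
  obtain ⟨f, hf, hf'⟩ := Set.not_subset.mp hIK.2
  by_cases hI : ∃ x, x ∈ I ∧ x ∉ J ∧ x ∉ K
  · by_cases hJ : ∃ x, x ∉ I ∧ x ∈ J ∧ x ∉ K
    · by_cases hK : ∃ x, x ∉ I ∧ x ∉ J ∧ x ∈ K
      · obtain ⟨x, hx⟩ := hI
        obtain ⟨y, hy⟩ := hJ
        obtain ⟨z, hz⟩ := hK
        exact no3 (p := x) (q := y) (r := z) ⟨key hx.2.1 hy.2.1, key hy.1 hx.1⟩
          ⟨key hy.2.2 hz.2.2, key hz.2.1 hy.2.1⟩ ⟨key hx.2.2 hz.2.2, key hz.1 hx.1⟩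
      · push Not at hK
        obtain ⟨x, hx⟩ := hI
        obtain ⟨y, hy⟩ := hJ
        have hdI : d ∈ I := by by_contra h; exact hd' (by_contra fun h' => hK d h h' hd)
        have hfJ : f ∈ J := by by_contra h; exact hK f hf' h hf
        exact no4 (I := K) (J := I) (K := J) (x := d) (y := f) (z := x) (w := y)
          (by tauto) (by tauto) (by tauto) (by tauto)
    · push Not at hJ
      obtain ⟨x, hx⟩ := hI
      have hbK : b ∈ K := by by_contra h; exact h (hJ b hb' hb)
      have hcI : c ∈ I := by by_contra h; exact hc' (hJ c h hc)
      by_cases hK : ∃ x, x ∉ I ∧ x ∉ J ∧ x ∈ K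
      · obtain ⟨z, hz⟩ := hK
        exact no4 (I := J) (J := I) (K := K) (x := c) (y := b) (z := x) (w := z)
          (by tauto) (by tauto) (by tauto) (by tauto)
      · push Not at hK
        have hdI : d ∈ I := by by_contra h; exact hd' (by_contra fun h' => hK d h h' hd)
        exact no3 (p := b) (q := c) (r := d) ⟨key hb' hcI, key hc' hbK⟩
          ⟨key hc' hd, key hd' hc⟩ ⟨key hb' hdI, key hd' hb⟩
  · push Not at hI
    have haK : a ∈ K := by by_contra h; exact h (hI a ha ha')
    have heJ : e ∈ J := by by_contra h; exact he' (hI e he h)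
    by_cases hJ : ∃ x, x ∉ I ∧ x ∈ J ∧ x ∉ K
    · obtain ⟨y, hy⟩ := hJ
      by_cases hK : ∃ x, x ∉ I ∧ x ∉ J ∧ x ∈ K
      · obtain ⟨z, hz⟩ := hK
        exact no4 (I := I) (J := J) (K := K) (x := e) (y := a) (z := y) (w := z)
          (by tauto) (by tauto) (by tauto) (by tauto)
      · push Not at hK
        have hfJ : f ∈ J := by by_contra h; exact hK f hf' h hf
        exact no3 (p := a) (q := e) (r := f) ⟨key ha' heJ, key he' haK⟩
          ⟨key he' hf, key hf' he⟩ ⟨key ha' hfJ, key hf' ha⟩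
    · push Not at hJ
      have hbK : b ∈ K := by by_contra h; exact h (hJ b hb' hb)
      exact no3 (p := a) (q := b) (r := e) ⟨key ha' hb, key hb' ha⟩
          ⟨key hb' he, key he' hbK⟩ ⟨key ha' heJ, key he' haK⟩

theorem free_of_widthLeTwo (h : WidthLeTwo (LowerSet P)) :
    TwoPlusTwoFree P ∧ OnePlusOnePlusOneFree P := by
  constructor
  · by_contra hn
    obtain ⟨p, p', q, q', hp, hq, hpq, hqp⟩ := not_twoPlusTwoFree_iff.mp hn
    -- Two chains $p<p'$, $q<q'$ give the antichain $\downarrow p'$, $\downarrow q'$, $\downarrow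
    -- p\cup\downarrow q$.
    refine h (LowerSet.Iic p') (LowerSet.Iic q') (LowerSet.Iic p ⊔ LowerSet.Iic q)
      ⟨⟨?_, ?_⟩, ⟨?_, ?_⟩, ⟨?_, ?_⟩⟩ <;>
      simp only [LowerSet.Iic_le, LowerSet.mem_Iic_iff, LowerSet.mem_sup_iff, sup_le_iff]
    · exact fun h => hpq (hp.le.trans h)
    · exact fun h => hqp (hq.le.trans h)
    · rintro (h | h)
      · exact hqp ((hq.le.trans h).trans hp.le)
      · exact hq.not_ge h
    · exact fun h => hpq h.1
    · rintro (h | h)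
      · exact hp.not_ge h
      · exact hpq ((hp.le.trans h).trans hq.le)
    · exact fun h => hqp h.2
  · by_contra hn
    obtain ⟨p, q, r, hpq, hqr, hpr⟩ := not_onePlusOnePlusOneFree_iff.mp hn
    refine h (LowerSet.Iic p) (LowerSet.Iic q) (LowerSet.Iic r) ⟨⟨?_, ?_⟩, ⟨?_, ?_⟩, ⟨?_, ?_⟩⟩ <;>
      simp [hpq.1, hpq.2, hqr.1, hqr.2, hpr.1, hpr.2]

end Forbidden

/-! ### Failure of the Khovanskii property -/

section Failure

variable {𝕜 L : Type*} [Field 𝕜] [Lattice L] {m : MonomialOrder L}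

theorem exists_edgeDeg_of_mem_adjoin (hm : IsCompatible 𝕜 m) {f : MvPolynomial L 𝕜}
    (hf : f ∈ Algebra.adjoin 𝕜 (m.leadingTerm '' hibiSet 𝕜 L)) {d : L →₀ ℕ}
    (hd : d ∈ f.support) : ∃ E, AllIncomp E ∧ edgeDeg E = d := by
  classical
  induction hf using Algebra.adjoin_induction generalizing d with
  | mem x hx =>
    obtain ⟨_, ⟨a, b, h1, h2, rfl⟩, rfl⟩ := hx
    rw [hm.leadingTerm_eq ⟨h1, h2⟩] at hd
    have := Finset.mem_singleton.mp (support_monomial_subset hd)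
    subst this
    exact ⟨{(a, b)}, by simp [AllIncomp, IncompRel, h1, h2], by simp [edgeDeg]⟩
  | algebraMap r =>
    rw [algebraMap_eq, C_apply] at hd
    have := Finset.mem_singleton.mp (support_monomial_subset hd)
    subst this
    exact ⟨0, AllIncomp.zero, rfl⟩
  | add x y _ _ hx hy =>
    rcases Finset.mem_union.mp (support_add hd) with h | h
    exacts [hx h, hy h]
  | mul x y _ _ hx hy =>
    obtain ⟨d₁, h₁, d₂, h₂, rfl⟩ := Finset.mem_add.mp (support_mul x y hd)
    obtain ⟨E₁, hE₁, rfl⟩ := hx h₁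
    obtain ⟨E₂, hE₂, rfl⟩ := hy h₂
    exact ⟨E₁ + E₂, hE₁.add hE₂, edgeDeg_add _ _⟩

/-- A nonzero element of the Hibi algebra over an interval of the lattice, all of whose monomials
are divisible by the variable of an end point of the interval, obstructs the Khovanskii
property. -/
theorem not_isKhovanskiiBasis (hm : IsCompatible 𝕜 m) {s t : L} {g h₁ h₂ : MvPolynomial L 𝕜}
    (hg : g ∈ hibiAlgebra 𝕜 L) (hg0 : g ≠ 0) (hgX : g = X s * h₁ + X t * h₂)
    (hsupp : g ∈ supported 𝕜 (Set.Icc s t)) :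
    ¬ IsKhovanskiiBasis m (hibiSet 𝕜 L) (hibiAlgebra 𝕜 L) := by
  classical
  rintro ⟨-, hK⟩
  have hmem : m.leadingTerm g ∈ Algebra.adjoin 𝕜 (m.leadingTerm '' hibiSet 𝕜 L) := by
    rw [← Subalgebra.mem_toSubmodule, hK]
    exact Submodule.subset_span ⟨g, hg, rfl⟩
  have hdg := m.degree_mem_support hg0
  have hd : m.degree g ∈ (m.leadingTerm g).support := by
    rw [m.support_leadingTerm' hg0]
    exact Finset.mem_singleton_self _
  obtain ⟨E, hE, hEd⟩ := exists_edgeDeg_of_mem_adjoin hm hmem hd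
  have hIcc : ∀ v, edgeDeg E v ≠ 0 → s ≤ v ∧ v ≤ t := by
    intro v hv
    rw [hEd] at hv
    refine mem_supported.mp hsupp (Finset.mem_coe.mpr ?_)
    exact (mem_vars_iff_mem_support v).mpr ⟨_, hdg, Finsupp.mem_support_iff.mpr hv⟩
  have hst : edgeDeg E s ≠ 0 ∨ edgeDeg E t ≠ 0 := by
    rw [hEd]
    by_contra! h0
    refine mem_support_iff.mp hdg ?_
    conv_lhs => rw [hgX]
    rw [coeff_add, coeff_X_mul', coeff_X_mul', if_neg, if_neg, add_zero]
    · simp [← hgX, h0.2]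
    · simp [← hgX, h0.1]
  -- The partner of $s$ or $t$ in its pair lies in $[s,t]$, hence is comparable to it.
  rcases hst with h0 | h0 <;> obtain ⟨e, he, rfl | rfl⟩ := mem_of_edgeDeg_ne_zero h0 <;>
    have h1 := hE e he <;> have h2 := edgeDeg_ne_zero_of_mem he
  · exact h1.1 (hIcc _ h2.2).1
  · exact h1.2 (hIcc _ h2.1).1
  · exact h1.2 (hIcc _ h2.2).2
  · exact h1.1 (hIcc _ h2.1).2

theorem hibiPoly_mem {a b : L} (h : IncompRel (· ≤ ·) a b) :
    hibiPoly 𝕜 a b ∈ hibiAlgebra 𝕜 L :=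
  Algebra.subset_adjoin ⟨a, b, h.1, h.2, rfl⟩

theorem hibiPoly_mem_supported {a b s t : L} (ha : a ∈ Set.Icc s t) (hb : b ∈ Set.Icc s t) :
    hibiPoly 𝕜 a b ∈ supported 𝕜 (Set.Icc s t) := by
  have hX : ∀ {v : L}, v ∈ Set.Icc s t → (X v : MvPolynomial L 𝕜) ∈ supported 𝕜 (Set.Icc s t) :=
    fun h => X_mem_supported.mpr h
  exact sub_mem (mul_mem (hX ha) (hX hb)) (mul_mem (hX ⟨le_inf ha.1 hb.1, inf_le_left.trans ha.2⟩)
    (hX ⟨ha.1.trans le_sup_left, sup_le ha.2 hb.2⟩))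

end Failure

/-! ### The cube and the grid as obstructions -/

section FailureCases

variable {𝕜 L : Type*} [Field 𝕜] [DistribLattice L] {m : MonomialOrder L}

/-- The Khovanskii property fails if the lattice contains a Boolean lattice with three atoms. -/
theorem not_isKhovanskiiBasis_of_boolean (hm : IsCompatible 𝕜 m) {a b c d : L}
    (hab : a ⊓ b = d) (hbc : b ⊓ c = d) (hac : a ⊓ c = d)
    (ha : ¬ a ≤ b ⊔ c) (hb : ¬ b ≤ a ⊔ c) (hc : ¬ c ≤ a ⊔ b) :
    ¬ IsKhovanskiiBasis m (hibiSet 𝕜 L) (hibiAlgebra 𝕜 L) := by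
  classical
  have hda : d ≤ a := hab ▸ inf_le_left
  have hdb : d ≤ b := hab ▸ inf_le_right
  have hdc : d ≤ c := hbc ▸ inf_le_right
  have i1 : IncompRel (· ≤ ·) a b :=
    ⟨fun h => ha (h.trans le_sup_left), fun h => hb (h.trans le_sup_left)⟩
  have i2 : IncompRel (· ≤ ·) (a ⊔ c) (b ⊔ c) :=
    ⟨fun h => ha (le_sup_left.trans h), fun h => hb (le_sup_left.trans h)⟩
  have i3 : IncompRel (· ≤ ·) b (a ⊔ c) := ⟨hb, fun h => i1.1 (le_sup_left.trans h)⟩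
  have i4 : IncompRel (· ≤ ·) a (b ⊔ c) := ⟨ha, fun h => i1.2 (le_sup_left.trans h)⟩
  have e1 : (a ⊔ c) ⊓ (b ⊔ c) = c := by rw [← sup_inf_right, hab, sup_eq_right.mpr hdc]
  have e2 : (a ⊔ c) ⊔ (b ⊔ c) = a ⊔ b ⊔ c := by rw [sup_sup_sup_comm, sup_idem]
  have e3 : b ⊓ (a ⊔ c) = d := by rw [inf_sup_left, inf_comm b a, hab, hbc, sup_idem]
  have e4 : b ⊔ (a ⊔ c) = a ⊔ b ⊔ c := by rw [← sup_assoc, sup_comm b a]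
  have e5 : a ⊓ (b ⊔ c) = d := by rw [inf_sup_left, hab, hac, sup_idem]
  have e6 : a ⊔ (b ⊔ c) = a ⊔ b ⊔ c := by rw [sup_assoc]
  -- Both products contain $x_ax_bx_{a\vee c}x_{b\vee c}$, which cancels; every other monomial
  -- involves the bottom or the top of the cube.
  have hg : hibiPoly 𝕜 a b * hibiPoly 𝕜 (a ⊔ c) (b ⊔ c) -
        hibiPoly 𝕜 b (a ⊔ c) * hibiPoly 𝕜 a (b ⊔ c) =
      X d * (X c * X (a ⊔ b) * X (a ⊔ b ⊔ c) + X b * X (a ⊔ c) * X (a ⊔ b ⊔ c) +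
        X a * X (b ⊔ c) * X (a ⊔ b ⊔ c) - X (a ⊔ b) * X (a ⊔ c) * X (b ⊔ c) -
        X d * X (a ⊔ b ⊔ c) ^ 2) + X (a ⊔ b ⊔ c) * (-(X a * X b * X c)) := by
    simp only [hibiPoly, hab, e1, e2, e3, e4, e5, e6]
    ring
  refine not_isKhovanskiiBasis hm (s := d) (t := a ⊔ b ⊔ c) ?_ ?_ hg ?_
  · exact sub_mem (mul_mem (hibiPoly_mem i1) (hibiPoly_mem i2))
      (mul_mem (hibiPoly_mem i3) (hibiPoly_mem i4))
  · intro h0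
    rw [hg] at h0
    -- At this point only the summand with the top variable survives, with value $-1$.
    have h1 := congrArg (eval fun v : L => if v = d then (0 : 𝕜) else 1) h0
    have na : a ≠ d := fun h => i1.1 (h.trans_le hdb)
    have nb : b ≠ d := fun h => i1.2 (h.trans_le hda)
    have nc : c ≠ d := fun h => hc (h.trans_le (hda.trans le_sup_left))
    have nt : a ⊔ b ⊔ c ≠ d := fun h =>
      i1.1 ((le_sup_left.trans le_sup_left).trans (h.trans_le hdb))
    simp [na, nb, nc, nt] at h1
  · have ja : a ∈ Set.Icc d (a ⊔ b ⊔ c) := ⟨hda, le_sup_left.trans le_sup_left⟩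
    have jb : b ∈ Set.Icc d (a ⊔ b ⊔ c) := ⟨hdb, le_sup_right.trans le_sup_left⟩
    have jac : a ⊔ c ∈ Set.Icc d (a ⊔ b ⊔ c) :=
      ⟨hda.trans le_sup_left, sup_le_sup_right le_sup_left _⟩
    have jbc : b ⊔ c ∈ Set.Icc d (a ⊔ b ⊔ c) :=
      ⟨hdb.trans le_sup_left, sup_le_sup_right le_sup_right _⟩
    exact sub_mem (mul_mem (hibiPoly_mem_supported ja jb) (hibiPoly_mem_supported jac jbc))
      (mul_mem (hibiPoly_mem_supported jb jac) (hibiPoly_mem_supported ja jbc))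

/-- The Khovanskii property fails if the lattice contains a product of two chains of length
two. -/
theorem not_isKhovanskiiBasis_of_grid (hm : IsCompatible 𝕜 m) {a a' b b' d : L}
    (ha : a < a') (hb : b < b') (hda : d ≤ a) (hdb : d ≤ b) (hd : a' ⊓ b' = d)
    (hab : ¬ a ≤ b') (hba : ¬ b ≤ a') :
    ¬ IsKhovanskiiBasis m (hibiSet 𝕜 L) (hibiAlgebra 𝕜 L) := by
  classical
  have i1 : IncompRel (· ≤ ·) a b :=
    ⟨fun h => hab (h.trans hb.le), fun h => hba (h.trans ha.le)⟩
  have i2 : IncompRel (· ≤ ·) a' b' := ⟨fun h => hab (ha.le.trans h), fun h => hba (hb.le.trans h)⟩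
  have i3 : IncompRel (· ≤ ·) a' b := ⟨fun h => i1.1 (ha.le.trans h), hba⟩
  have i4 : IncompRel (· ≤ ·) a b' := ⟨hab, fun h => i1.2 (hb.le.trans h)⟩
  have e1 : a ⊓ b = d := le_antisymm (hd ▸ inf_le_inf ha.le hb.le) (le_inf hda hdb)
  have e2 : a' ⊓ b = d :=
    le_antisymm (hd ▸ inf_le_inf_left _ hb.le) (le_inf (hda.trans ha.le) hdb)
  have e3 : a ⊓ b' = d :=
    le_antisymm (hd ▸ inf_le_inf_right _ ha.le) (le_inf hda (hdb.trans hb.le))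
  have hg : hibiPoly 𝕜 a b * hibiPoly 𝕜 a' b' - hibiPoly 𝕜 a' b * hibiPoly 𝕜 a b' =
      X d * (X d * X (a ⊔ b) * X (a' ⊔ b') - X a * X b * X (a' ⊔ b') -
        X a' * X b' * X (a ⊔ b) + X a' * X b * X (a ⊔ b') + X a * X b' * X (a' ⊔ b) -
        X d * X (a' ⊔ b) * X (a ⊔ b')) + X (a' ⊔ b') * 0 := by
    simp only [hibiPoly, e1, e2, e3, hd]
    ring
  refine not_isKhovanskiiBasis hm (s := d) (t := a' ⊔ b') ?_ ?_ hg ?_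
  · exact sub_mem (mul_mem (hibiPoly_mem i1) (hibiPoly_mem i2))
      (mul_mem (hibiPoly_mem i3) (hibiPoly_mem i4))
  · intro h0
    rw [hg] at h0
    -- The point isolates the monomial $x_dx_{a'}x_{b'}x_{a\vee b}$, which has coefficient $-1$.
    have h1 := congrArg
      (eval fun v : L => if v = d ∨ v = a' ∨ v = b' ∨ v = a ⊔ b then (1 : 𝕜) else 0) h0
    have ka : ¬ a' ≤ a ⊔ b := fun h => ha.not_ge <| by
      rw [← inf_eq_left.mpr h, inf_sup_left, e2]
      exact sup_le inf_le_right hda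
    have kb : ¬ b' ≤ a ⊔ b := fun h => hb.not_ge <| by
      rw [← inf_eq_left.mpr h, inf_sup_left, inf_comm b' a, e3]
      exact sup_le hdb inf_le_right
    have na : ¬ (a = d ∨ a = a' ∨ a = b' ∨ a = a ⊔ b) := by
      rintro (h | h | h | h)
      exacts [i1.1 (h.trans_le hdb), ha.ne h, hab h.le, i1.2 (le_sup_right.trans h.ge)]
    have nb : ¬ (b = d ∨ b = a' ∨ b = b' ∨ b = a ⊔ b) := by
      rintro (h | h | h | h)
      exacts [i1.2 (h.trans_le hda), hba h.le, hb.ne h, i1.1 (le_sup_left.trans h.ge)]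
    have nt : ¬ (a' ⊔ b' = d ∨ a' ⊔ b' = a' ∨ a' ⊔ b' = b' ∨ a' ⊔ b' = a ⊔ b) := by
      rintro (h | h | h | h)
      exacts [i3.1 ((le_sup_left.trans h.le).trans hdb), i2.2 (le_sup_right.trans h.le),
        i2.1 (le_sup_left.trans h.le), ka (le_sup_left.trans h.le)]
    have n1 : ¬ (a' ⊔ b = d ∨ a' ⊔ b = a' ∨ a' ⊔ b = b' ∨ a' ⊔ b = a ⊔ b) := by
      rintro (h | h | h | h)
      exacts [i3.1 ((le_sup_left.trans h.le).trans hdb), i3.2 (le_sup_right.trans h.le),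
        i2.1 (le_sup_left.trans h.le), ka (le_sup_left.trans h.le)]
    have n2 : ¬ (a ⊔ b' = d ∨ a ⊔ b' = a' ∨ a ⊔ b' = b' ∨ a ⊔ b' = a ⊔ b) := by
      rintro (h | h | h | h)
      exacts [i1.1 ((le_sup_left.trans h.le).trans hdb), i2.2 (le_sup_right.trans h.le),
        i4.1 (le_sup_left.trans h.le), kb (le_sup_right.trans h.le)]
    simp only [map_add, map_sub, map_mul, eval_X, if_neg na, if_neg nb, if_neg nt, if_neg n1,
      if_neg n2, true_or, or_true, if_true, map_zero] at h1
    simp at h1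
  · have ja : a ∈ Set.Icc d (a' ⊔ b') := ⟨hda, ha.le.trans le_sup_left⟩
    have jb : b ∈ Set.Icc d (a' ⊔ b') := ⟨hdb, hb.le.trans le_sup_right⟩
    have ja' : a' ∈ Set.Icc d (a' ⊔ b') := ⟨hda.trans ha.le, le_sup_left⟩
    have jb' : b' ∈ Set.Icc d (a' ⊔ b') := ⟨hdb.trans hb.le, le_sup_right⟩
    exact sub_mem (mul_mem (hibiPoly_mem_supported ja jb) (hibiPoly_mem_supported ja' jb'))
      (mul_mem (hibiPoly_mem_supported ja' jb) (hibiPoly_mem_supported ja jb'))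

end FailureCases

theorem free_of_isKhovanskiiBasis {𝕜 P : Type*} [Field 𝕜] [PartialOrder P]
    {m : MonomialOrder (LowerSet P)} (hm : IsCompatible 𝕜 m)
    (h : IsKhovanskiiBasis m (hibiSet 𝕜 (LowerSet P)) (hibiAlgebra 𝕜 (LowerSet P))) :
    TwoPlusTwoFree P ∧ OnePlusOnePlusOneFree P := by
  constructor
  · by_contra hn
    obtain ⟨p, p', q, q', hp, hq, hpq, hqp⟩ := not_twoPlusTwoFree_iff.mp hn
    have hpq' : ¬ p' ≤ q' := fun h => hpq (hp.le.trans h)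
    have hqp' : ¬ q' ≤ p' := fun h => hqp (hq.le.trans h)
    -- Joining the smaller ideals with $\downarrow p'\cap\downarrow q'$ gives all four pairs the
    -- same meet.
    refine not_isKhovanskiiBasis_of_grid hm
      (a := LowerSet.Iic p ⊔ LowerSet.Iic p' ⊓ LowerSet.Iic q') (a' := LowerSet.Iic p')
      (b := LowerSet.Iic q ⊔ LowerSet.Iic p' ⊓ LowerSet.Iic q') (b' := LowerSet.Iic q')
      (lt_of_le_not_ge (sup_le ?_ inf_le_left) ?_) (lt_of_le_not_ge (sup_le ?_ inf_le_right) ?_)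
      le_sup_right le_sup_right rfl ?_ ?_ h
    · exact LowerSet.Iic_le.mpr hp.le
    · simp [hp.not_ge, hpq']
    · exact LowerSet.Iic_le.mpr hq.le
    · simp [hq.not_ge, hqp']
    · simp [hpq]
    · simp [hqp]
  · by_contra hn
    obtain ⟨p, q, r, hpq, hqr, hpr⟩ := not_onePlusOnePlusOneFree_iff.mp hn
    -- With $d$ containing all pairwise meets, distributivity gives $(I\vee d)\wedge(J\vee
    -- d)=(I\wedge J)\vee d=d$.
    let d := LowerSet.Iic p ⊓ LowerSet.Iic q ⊔ LowerSet.Iic q ⊓ LowerSet.Iic r ⊔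
      LowerSet.Iic p ⊓ LowerSet.Iic r
    have hd : ∀ x : P, x ∈ d ↔ (x ≤ p ∧ x ≤ q ∨ x ≤ q ∧ x ≤ r) ∨ x ≤ p ∧ x ≤ r := fun x => by
      simp [d]
    refine not_isKhovanskiiBasis_of_boolean hm
      (a := LowerSet.Iic p ⊔ d) (b := LowerSet.Iic q ⊔ d) (c := LowerSet.Iic r ⊔ d) (d := d)
      ?_ ?_ ?_ ?_ ?_ ?_ h
    · rw [← sup_inf_right, sup_eq_right]
      exact le_sup_left.trans le_sup_left
    · rw [← sup_inf_right, sup_eq_right]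
      exact le_sup_right.trans le_sup_left
    · rw [← sup_inf_right, sup_eq_right]
      exact le_sup_right
    · simp [hd, hpq.1, hpr.1]
    · simp [hd, hpq.2, hqr.1]
    · simp [hd, hqr.2, hpr.2]

/-! ### Generalized snake posets have width two -/

section Snake

/-- The letter of index `k`, with the convention that the letter of index zero is `R`. -/
def snakeLetter (w : ℕ → SnakeLetter) : ℕ → SnakeLetter
  | 0 => .R
  | k + 1 => w (k + 1)

variable {w : ℕ → SnakeLetter} {l : ℕ}

theorem snakeCover_iff {i j : ℕ} :
    SnakeCover w l i j ↔ (i = 0 ∧ (j = 1 ∨ j = 2)) ∨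
      (∃ k ≤ l, (i = 2 * k + 1 ∨ i = 2 * k + 2) ∧ j = 2 * k + 3) ∨
      ∃ k < l, j = 2 * k + 4 ∧
        (snakeLetter w k ≠ snakeLetter w (k + 1) ∧ i = 2 * k + 1 ∨
          snakeLetter w k = snakeLetter w (k + 1) ∧ i = 2 * k + 2) := by
  -- Setting letter zero to `R` absorbs the special rule for the first letter into the comparison of
  -- consecutive letters.
  have hL : ∀ k, (k + 1 = 1 ∧ w 1 = .L ∨ 2 ≤ k + 1 ∧ w k ≠ w (k + 1)) ↔
      snakeLetter w k ≠ snakeLetter w (k + 1) := by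
    rintro (_ | k)
    · cases h : w 1 <;> simp [snakeLetter, h]
    · simp [snakeLetter]
  have hR : ∀ k, (k + 1 = 1 ∧ w 1 = .R ∨ 2 ≤ k + 1 ∧ w k = w (k + 1)) ↔
      snakeLetter w k = snakeLetter w (k + 1) := by
    rintro (_ | k)
    · cases h : w 1 <;> simp [snakeLetter, h]
    · simp [snakeLetter]
  induction l with
  | zero =>
    simp only [SnakeCover, Nat.le_zero, exists_eq_left, Nat.not_lt_zero, false_and, exists_false,
      or_false]
    omega
  | succ l ih =>
    simp only [SnakeCover, hL, hR, ih]
    constructor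
    · rintro ((h | ⟨k, hk, h⟩ | ⟨k, hk, h⟩) | h | h | ⟨h, h'⟩ | ⟨h, h'⟩)
      · exact .inl h
      · exact .inr (.inl ⟨k, hk.trans l.le_succ, h⟩)
      · exact .inr (.inr ⟨k, hk.trans l.lt_succ_self, h⟩)
      · exact .inr (.inl ⟨l + 1, le_rfl, by omega⟩)
      · exact .inr (.inl ⟨l + 1, le_rfl, by omega⟩)
      · exact .inr (.inr ⟨l, l.lt_succ_self, by omega, .inl ⟨h, by omega⟩⟩)
      · exact .inr (.inr ⟨l, l.lt_succ_self, by omega, .inr ⟨h, by omega⟩⟩)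
    · rintro (h | ⟨k, hk, h⟩ | ⟨k, hk, h, h'⟩)
      · exact .inl (.inl h)
      · rcases Nat.le_succ_iff.mp hk with hk | rfl
        · exact .inl (.inr (.inl ⟨k, hk, h⟩))
        · right
          omega
      · rcases Nat.lt_succ_iff_lt_or_eq.mp hk with hk | rfl
        · exact .inl (.inr (.inr ⟨k, hk, h, h'⟩))
        · right; right; right
          rcases h' with ⟨h', hi⟩ | ⟨h', hi⟩
          · exact .inl ⟨h', by omega, by omega⟩
          · exact .inr ⟨h', by omega, by omega⟩

theorem SnakePoset.le_of_cover {a b : SnakePoset w l} (h : SnakeCover w l a.idx b.idx) : a ≤ b :=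
  Relation.ReflTransGen.single h

open Classical in
/-- The element at height `k + 1` of the left or right boundary chain. -/
noncomputable def snakeChain (w : ℕ → SnakeLetter) {l : ℕ} (c : SnakeLetter) (k : ℕ)
    (hk : k ≤ l) : SnakePoset w l :=
  ⟨⟨if c = snakeLetter w k then 2 * k + 1 else 2 * k + 2, by split_ifs <;> omega⟩⟩

theorem snakeChain_le_succ (c : SnakeLetter) {k : ℕ} (hk : k + 1 ≤ l) :
    snakeChain w c k (Nat.le_of_succ_le hk) ≤ snakeChain w c (k + 1) hk := by
  apply SnakePoset.le_of_cover
  rw [snakeCover_iff]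
  simp only [snakeChain]
  -- The next element is $\alpha_{2k+3}$, which covers both candidates, or $\alpha_{2k+4}$, whose
  -- lower cover lies on the same side because there are only two letters.
  by_cases h : c = snakeLetter w (k + 1)
  · refine .inr (.inl ⟨k, Nat.le_of_succ_le hk, ?_, by simp [h]; ring⟩)
    split_ifs <;> simp
  · refine .inr (.inr ⟨k, hk, by simp [h]; ring, ?_⟩)
    cases c <;> cases h1 : snakeLetter w k <;> cases h2 : snakeLetter w (k + 1) <;> simp_all

theorem snakeChain_mono (c : SnakeLetter) {k k' : ℕ} (h : k ≤ k') (hk : k' ≤ l) :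
    snakeChain w c k (h.trans hk) ≤ snakeChain w c k' hk := by
  induction h with
  | refl => exact le_rfl
  | step h ih => exact (ih (Nat.le_of_succ_le hk)).trans (snakeChain_le_succ c hk)

theorem exists_eq_snakeChain {a b : SnakePoset w l} (h : IncompRel (· ≤ ·) a b) :
    ∃ c k, ∃ hk : k ≤ l, a = snakeChain w c k hk := by
  have hall : ∀ x : SnakePoset w l, (x.idx : ℕ) = 0 ∨ (x.idx : ℕ) = 2 * l + 3 ∨
      ∃ c k, ∃ hk : k ≤ l, x = snakeChain w c k hk := by
    rintro ⟨⟨i, hi⟩⟩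
    by_cases h0 : i = 0
    · exact .inl h0
    by_cases h1 : i = 2 * l + 3
    · exact .inr (.inl h1)
    obtain ⟨k, hk | hk⟩ : ∃ k, i = 2 * k + 1 ∨ i = 2 * k + 2 := ⟨(i - 1) / 2, by omega⟩
    · refine .inr (.inr ⟨snakeLetter w k, k, by omega, ?_⟩)
      simp [snakeChain, hk]
    · refine .inr (.inr ⟨match snakeLetter w k with | .L => .R | .R => .L, k, by omega, ?_⟩)
      cases h : snakeLetter w k <;> simp [snakeChain, hk, h]
  have hbot : ∀ x y : SnakePoset w l, (x.idx : ℕ) = 0 → x ≤ y := by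
    have hmin : ∀ x : SnakePoset w l, (x.idx : ℕ) = 0 → ∀ c k hk, x ≤ snakeChain w c k hk := by
      refine fun x hx c k hk => le_trans ?_ (snakeChain_mono c (Nat.zero_le k) hk)
      apply SnakePoset.le_of_cover
      rw [snakeCover_iff]
      refine .inl ⟨hx, ?_⟩
      simp only [snakeChain]
      split_ifs <;> simp
    intro x y hx
    rcases hall y with hy | hy | ⟨c, k, hk, rfl⟩
    · cases x; cases y
      exact le_of_eq (by congr 1; exact Fin.ext (hx.trans hy.symm))
    · refine (hmin x hx .L l le_rfl).trans (SnakePoset.le_of_cover ?_)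
      rw [snakeCover_iff]
      refine .inr (.inl ⟨l, le_rfl, ?_, hy⟩)
      simp only [snakeChain]
      split_ifs <;> simp
    · exact hmin x hx c k hk
  have htop : ∀ x y : SnakePoset w l, (y.idx : ℕ) = 2 * l + 3 → x ≤ y := by
    intro x y hy
    rcases hall x with hx | hx | ⟨c, k, hk, rfl⟩
    · exact hbot x y hx
    · cases x; cases y
      exact le_of_eq (by congr 1; exact Fin.ext (hx.trans hy.symm))
    · refine (snakeChain_mono c hk le_rfl).trans (SnakePoset.le_of_cover ?_)
      rw [snakeCover_iff]
      refine .inr (.inl ⟨l, le_rfl, ?_, hy⟩)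
      simp only [snakeChain]
      split_ifs <;> simp
  rcases hall a with ha | ha | ha
  · exact absurd (hbot a b ha) h.1
  · exact absurd (htop b a ha) h.2
  · exact ha

theorem widthLeTwo_snakePoset : WidthLeTwo (SnakePoset w l) := by
  rintro a b c ⟨hab, hbc, hac⟩
  have key : ∀ {x y : SnakePoset w l} {s : SnakeLetter} {k k' : ℕ} {hk : k ≤ l} {hk' : k' ≤ l},
      IncompRel (· ≤ ·) x y → x = snakeChain w s k hk → y = snakeChain w s k' hk' → False := by
    rintro _ _ s k k' hk hk' h rfl rfl
    rcases le_total k k' with hkk | hkk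
    exacts [h.1 (snakeChain_mono s hkk hk'), h.2 (snakeChain_mono s hkk hk)]
  obtain ⟨s₁, k₁, h₁, ha⟩ := exists_eq_snakeChain hab
  obtain ⟨s₂, k₂, h₂, hb⟩ := exists_eq_snakeChain hbc
  obtain ⟨s₃, k₃, h₃, hc⟩ := exists_eq_snakeChain hbc.symm
  cases s₁ <;> cases s₂ <;> cases s₃ <;>
    first
    | exact key hab ha hb
    | exact key hbc hb hc
    | exact key hac ha hc

theorem widthLeTwo_of_isGeneralizedSnakePoset {Q : Type*} [PartialOrder Q]
    (h : IsGeneralizedSnakePoset Q) : WidthLeTwo Q := by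
  obtain ⟨l, w, ⟨e⟩⟩ := h
  intro a b c habc
  refine widthLeTwo_snakePoset (w := w) (l := l) (e a) (e b) (e c) ?_
  simpa [IncompRel] using habc

end Snake

/-! ### Irreducible posets of ideals of width two are generalized snake posets -/

section Ideals

variable {P : Type*} [PartialOrder P] [Finite P]

theorem eq_of_le_of_ncard_le {I J : LowerSet P} (h : I ≤ J)
    (hc : (J : Set P).ncard ≤ (I : Set P).ncard) : I = J :=
  SetLike.coe_injective (Set.eq_of_subset_of_ncard_le h hc)

theorem exists_ncard_eq_succ {I J : LowerSet P} (h : I < J) :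
    ∃ M : LowerSet P, I ≤ M ∧ M ≤ J ∧ (M : Set P).ncard = (I : Set P).ncard + 1 := by
  have hne : ((J : Set P) \ I).Nonempty := Set.sdiff_nonempty.mpr h.not_ge
  obtain ⟨x, hx⟩ := (Set.toFinite ((J : Set P) \ I)).exists_minimal hne
  refine ⟨⟨insert x (I : Set P), ?_⟩, Set.subset_insert _ _,
    Set.insert_subset hx.1.1 h.le, Set.ncard_insert_of_notMem hx.1.2⟩
  rintro a b hba (rfl | ha)
  · by_cases hb : b ∈ I
    · exact .inr hb
    · exact .inl (le_antisymm hba (hx.2 ⟨LowerSet.lower _ hba hx.1.1, hb⟩ hba))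
  · exact .inr (LowerSet.lower _ hba ha)

theorem exists_ncard_eq {I J : LowerSet P} (h : I ≤ J) {k : ℕ} (hI : (I : Set P).ncard ≤ k)
    (hJ : k ≤ (J : Set P).ncard) :
    ∃ M : LowerSet P, I ≤ M ∧ M ≤ J ∧ (M : Set P).ncard = k := by
  induction k, hI using Nat.le_induction with
  | base => exact ⟨I, le_rfl, h, rfl⟩
  | succ k hk ih =>
    obtain ⟨M, h1, h2, h3⟩ := ih (Nat.le_of_succ_le hJ)
    have hlt : M < J := lt_of_le_of_ne h2 (by rintro rfl; omega)
    obtain ⟨N, h4, h5, h6⟩ := exists_ncard_eq_succ hlt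
    exact ⟨N, h1.trans h4, h5, by omega⟩

theorem lowerSet_covBy_iff {I J : LowerSet P} :
    I ⋖ J ↔ I ≤ J ∧ (J : Set P).ncard = (I : Set P).ncard + 1 := by
  constructor
  · intro h
    obtain ⟨M, h1, h2, h3⟩ := exists_ncard_eq_succ h.lt
    rcases h.eq_or_eq h1 h2 with rfl | rfl
    · omega
    · exact ⟨h.le, h3⟩
  · rintro ⟨h, hc⟩
    refine ⟨lt_of_le_of_ne h (by rintro rfl; omega), fun M h1 h2 => ?_⟩
    have h3 := Set.ncard_lt_ncard (LowerSet.coe_ssubset_coe.mpr h1)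
    have h4 := Set.ncard_lt_ncard (LowerSet.coe_ssubset_coe.mpr h2)
    omega

theorem incompRel_of_ncard_eq {I J : LowerSet P} (hne : I ≠ J)
    (hc : (I : Set P).ncard = (J : Set P).ncard) : IncompRel (· ≤ ·) I J :=
  ⟨fun h => hne (eq_of_le_of_ncard_le h hc.ge), fun h => hne (eq_of_le_of_ncard_le h hc.le).symm⟩

theorem eq_or_eq_of_ncard_eq (hL : WidthLeTwo (LowerSet P)) {I J M : LowerSet P} (hne : I ≠ J)
    (hI : (I : Set P).ncard = (M : Set P).ncard) (hJ : (J : Set P).ncard = (M : Set P).ncard) :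
    M = I ∨ M = J := by
  by_contra! h
  exact hL I J M ⟨incompRel_of_ncard_eq hne (hI.trans hJ.symm),
    incompRel_of_ncard_eq h.2.symm hJ, incompRel_of_ncard_eq h.1.symm hI⟩

/-- If $I$ were the only ideal of its size, then for $b\notin I$ the ideal $\downarrow b$ could not
extend to one of size $|I|$, so it would contain one, namely $I$. Then $P=I\oplus(P\setminus I)$. -/
theorem exists_ne_of_irreducible (hP : OrdinalSumIrreducible P) {I : LowerSet P}
    (h0 : 0 < (I : Set P).ncard) (h1 : (I : Set P).ncard < Nat.card P) :
    ∃ J : LowerSet P, J ≠ I ∧ (J : Set P).ncard = (I : Set P).ncard := by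
  by_contra! hne
  refine hP ⟨I, (I : Set P)ᶜ, ?_, ?_, disjoint_compl_right, Set.union_compl_self _, ?_⟩
  · intro h
    rw [h, Set.ncard_univ] at h1
    exact h1.false
  · intro h
    rw [Set.compl_univ_iff.mp h, Set.ncard_empty] at h0
    exact h0.false
  have hcross : ∀ a b : P, a ∈ I → b ∉ I → a ≤ b := by
    intro a b ha hb
    rcases le_total (LowerSet.Iic b : Set P).ncard (I : Set P).ncard with hc | hc
    · have hle : (LowerSet.Iic b) ≤ ⊤ := le_top
      obtain ⟨M, hM1, -, hM3⟩ := exists_ncard_eq hle hc (by simpa [Set.ncard_univ] using h1.le)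
      have hM : M = I := by_contra fun h => hne M h hM3
      exact absurd (hM ▸ hM1 (LowerSet.mem_Iic_iff.mpr le_rfl)) hb
    · have hle : ⊥ ≤ LowerSet.Iic b := bot_le
      obtain ⟨M, -, hM2, hM3⟩ := exists_ncard_eq hle (by simp) hc
      have hM : M = I := by_contra fun h => hne M h hM3
      exact LowerSet.mem_Iic_iff.mp (hM2 (hM ▸ ha))
  intro a b
  constructor
  · intro hab
    by_cases ha : a ∈ I
    · by_cases hb : b ∈ I
      · exact .inl ⟨ha, hb, hab⟩
      · exact .inr (.inr ⟨ha, hb⟩)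
    · exact .inr (.inl ⟨ha, fun hb => ha (LowerSet.lower _ hab hb), hab⟩)
  · rintro (h | h | h)
    exacts [h.2.2, h.2.2, hcross a b h.1 h.2]

theorem ncard_sup_add_ncard_inf (I J : LowerSet P) :
    ((I ⊔ J : LowerSet P) : Set P).ncard + ((I ⊓ J : LowerSet P) : Set P).ncard =
      (I : Set P).ncard + (J : Set P).ncard := by
  rw [LowerSet.coe_sup, LowerSet.coe_inf]
  exact Set.ncard_union_add_ncard_inter _ _

/-- Otherwise $I\cap J$ misses at least two elements of $I$. Take $M\subseteq I$ one element smaller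
than $I$ and $N\subseteq J$ one larger than $I\cap J$, both containing $I\cap J$. Then $|M\cup
N|=|I|$, but $M\cup N$ is neither $I$ nor $J$: a third ideal of that size. -/
theorem ncard_sup_of_ncard_eq (hL : WidthLeTwo (LowerSet P)) {I J : LowerSet P} (hne : I ≠ J)
    (hc : (I : Set P).ncard = (J : Set P).ncard) :
    ((I ⊔ J : LowerSet P) : Set P).ncard = (I : Set P).ncard + 1 := by
  have hinc := incompRel_of_ncard_eq hne hc
  have hlt := Set.ncard_lt_ncard (LowerSet.coe_ssubset_coe.mpr (inf_lt_left.mpr hinc.1))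
  have hsum := ncard_sup_add_ncard_inf I J
  by_contra hne'
  have h2 : ((I ⊓ J : LowerSet P) : Set P).ncard + 2 ≤ (I : Set P).ncard := by omega
  obtain ⟨M, hM1, hM2, hM3⟩ := exists_ncard_eq (inf_le_left : I ⊓ J ≤ I)
    (k := (I : Set P).ncard - 1) (by omega) (by omega)
  obtain ⟨N, hN1, hN2, hN3⟩ := exists_ncard_eq (inf_le_right : I ⊓ J ≤ J)
    (k := ((I ⊓ J : LowerSet P) : Set P).ncard + 1) (by omega) (by omega)
  have hMN : M ⊓ N = I ⊓ J := le_antisymm (inf_le_inf hM2 hN2) (le_inf hM1 hN1)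
  have hsum' := ncard_sup_add_ncard_inf M N
  rw [hMN] at hsum'
  have mono : ∀ {A B : LowerSet P}, A ≤ B → (A : Set P).ncard ≤ (B : Set P).ncard :=
    fun h => Set.ncard_le_ncard h
  rcases eq_or_eq_of_ncard_eq hL hne (M := M ⊔ N) (by omega) (by omega) with h | h
  · have := mono (le_inf (le_sup_right.trans h.le) hN2)
    omega
  · have := mono (le_inf hM2 (le_sup_left.trans h.le))
    omega

end Ideals

/-! ### Labelling ideals by the snake indices -/

section Construction

variable {P : Type*} [PartialOrder P]

open Classical in
/-- Another ideal of the same cardinality, if there is one. -/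
noncomputable def otherIdeal (I : LowerSet P) : LowerSet P :=
  if h : ∃ J : LowerSet P, J ≠ I ∧ (J : Set P).ncard = (I : Set P).ncard then h.choose else I

theorem otherIdeal_spec [Finite P] (hP : OrdinalSumIrreducible P)
    {I : LowerSet P} (h0 : 0 < (I : Set P).ncard) (h1 : (I : Set P).ncard < Nat.card P) :
    otherIdeal I ≠ I ∧ (otherIdeal I : Set P).ncard = (I : Set P).ncard := by
  have h := exists_ne_of_irreducible hP h0 h1
  rw [otherIdeal, dif_pos h]
  exact h.choose_spec

/-- The sequence of ideals `I₀`, `I₁ = I₀ ∪ I₀'`, `I₂ = I₁ ∪ I₁'`, …, where `I'` denotes the other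
ideal of the same cardinality. -/
noncomputable def joinSeq (I₀ : LowerSet P) : ℕ → LowerSet P
  | 0 => I₀
  | k + 1 => joinSeq I₀ k ⊔ otherIdeal (joinSeq I₀ k)

/-- The element `α_i` of the generalized snake poset as an ideal. -/
noncomputable def snakeIdeal (I₀ : LowerSet P) (i : ℕ) : LowerSet P :=
  if i = 0 then ⊥ else
    if i % 2 = 1 then joinSeq I₀ (i / 2) else otherIdeal (joinSeq I₀ (i / 2 - 1))

theorem snakeIdeal_zero (I₀ : LowerSet P) : snakeIdeal I₀ 0 = ⊥ := rfl

theorem snakeIdeal_odd (I₀ : LowerSet P) (k : ℕ) :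
    snakeIdeal I₀ (2 * k + 1) = joinSeq I₀ k := by
  have h1 : (2 * k + 1) % 2 = 1 := by omega
  have h2 : (2 * k + 1) / 2 = k := by omega
  simp [snakeIdeal, h1, h2]

theorem snakeIdeal_even (I₀ : LowerSet P) (k : ℕ) :
    snakeIdeal I₀ (2 * k + 2) = otherIdeal (joinSeq I₀ k) := by
  have h1 : (2 * k + 2) % 2 = 0 := by omega
  simp [snakeIdeal, h1]

open Classical in
/-- The word of the generalized snake poset of ideals: the letter changes when the new element
covers the previous join. -/
noncomputable def snakeWord (I₀ : LowerSet P) : ℕ → SnakeLetter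
  | 0 => .R
  | k + 1 =>
    if joinSeq I₀ k ≤ otherIdeal (joinSeq I₀ (k + 1)) then
      match snakeWord I₀ k with
      | .L => .R
      | .R => .L
    else snakeWord I₀ k

theorem snakeLetter_snakeWord (I₀ : LowerSet P) (k : ℕ) :
    snakeLetter (snakeWord I₀) k = snakeWord I₀ k := by
  cases k <;> rfl

theorem snakeWord_succ_eq_iff (I₀ : LowerSet P) (k : ℕ) :
    snakeWord I₀ k = snakeWord I₀ (k + 1) ↔
      ¬ joinSeq I₀ k ≤ otherIdeal (joinSeq I₀ (k + 1)) := by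
  by_cases h : joinSeq I₀ k ≤ otherIdeal (joinSeq I₀ (k + 1))
  · rw [snakeWord, if_pos h]
    cases snakeWord I₀ k <;> simp [h]
  · rw [snakeWord, if_neg h]
    simp [h]

end Construction

/-! ### The labelling is an isomorphism -/

section Isomorphism

variable {P : Type*} [PartialOrder P] [Finite P] {I₀ : LowerSet P} {l : ℕ}

theorem ncard_joinSeq (hP : OrdinalSumIrreducible P) (hL : WidthLeTwo (LowerSet P))
    (hcard : Nat.card P = l + 2) (hI₀ : (I₀ : Set P).ncard = 1) {k : ℕ} (hk : k ≤ l + 1) :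
    (joinSeq I₀ k : Set P).ncard = k + 1 := by
  induction k with
  | zero => exact hI₀
  | succ k ih =>
    have h := ih (by omega)
    obtain ⟨h1, h2⟩ := otherIdeal_spec hP (I := joinSeq I₀ k) (by omega) (by omega)
    rw [joinSeq, ncard_sup_of_ncard_eq hL h1.symm h2.symm, h]

theorem otherIdeal_joinSeq (hP : OrdinalSumIrreducible P) (hL : WidthLeTwo (LowerSet P))
    (hcard : Nat.card P = l + 2) (hI₀ : (I₀ : Set P).ncard = 1) {k : ℕ} (hk : k ≤ l) :
    otherIdeal (joinSeq I₀ k) ≠ joinSeq I₀ k ∧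
      (otherIdeal (joinSeq I₀ k) : Set P).ncard = k + 1 := by
  have h := ncard_joinSeq hP hL hcard hI₀ (k := k) (by omega)
  have := otherIdeal_spec hP (I := joinSeq I₀ k) (by omega) (by omega)
  rwa [h] at this

theorem ncard_snakeIdeal (hP : OrdinalSumIrreducible P) (hL : WidthLeTwo (LowerSet P))
    (hcard : Nat.card P = l + 2) (hI₀ : (I₀ : Set P).ncard = 1) {i : ℕ} (hi : i < 2 * l + 4) :
    (snakeIdeal I₀ i : Set P).ncard = (i + 1) / 2 := by
  by_cases h0 : i = 0
  · subst h0; simp [snakeIdeal_zero]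
  obtain ⟨k, rfl | rfl⟩ : ∃ k, i = 2 * k + 1 ∨ i = 2 * k + 2 := ⟨(i - 1) / 2, by omega⟩
  · rw [snakeIdeal_odd, ncard_joinSeq hP hL hcard hI₀ (by omega)]
    omega
  · rw [snakeIdeal_even, (otherIdeal_joinSeq hP hL hcard hI₀ (by omega)).2]
    omega

theorem snakeIdeal_injective (hP : OrdinalSumIrreducible P) (hL : WidthLeTwo (LowerSet P))
    (hcard : Nat.card P = l + 2) (hI₀ : (I₀ : Set P).ncard = 1) {i j : ℕ} (hi : i < 2 * l + 4)
    (hj : j < 2 * l + 4) (h : snakeIdeal I₀ i = snakeIdeal I₀ j) : i = j := by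
  wlog hij : i ≤ j generalizing i j
  · exact (this hj hi h.symm (by omega)).symm
  by_contra hne
  have h1 := ncard_snakeIdeal hP hL hcard hI₀ hi
  have h2 := ncard_snakeIdeal hP hL hcard hI₀ hj
  rw [h] at h1
  obtain ⟨k, rfl, rfl⟩ : ∃ k, i = 2 * k + 1 ∧ j = 2 * k + 2 :=
    ⟨(i - 1) / 2, by omega, by omega⟩
  rw [snakeIdeal_odd, snakeIdeal_even] at h
  exact (otherIdeal_joinSeq hP hL hcard hI₀ (by omega)).1 h.symm

theorem eq_joinSeq_or_eq_otherIdeal (hP : OrdinalSumIrreducible P)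
    (hL : WidthLeTwo (LowerSet P)) (hcard : Nat.card P = l + 2)
    (hI₀ : (I₀ : Set P).ncard = 1) {k : ℕ} (hk : k ≤ l) {M : LowerSet P}
    (hM : (M : Set P).ncard = k + 1) : M = joinSeq I₀ k ∨ M = otherIdeal (joinSeq I₀ k) := by
  obtain ⟨h1, h2⟩ := otherIdeal_joinSeq hP hL hcard hI₀ hk
  exact eq_or_eq_of_ncard_eq hL h1.symm
    ((ncard_joinSeq hP hL hcard hI₀ (by omega)).trans hM.symm) (h2.trans hM.symm)

theorem exists_snakeIdeal_eq (hP : OrdinalSumIrreducible P) (hL : WidthLeTwo (LowerSet P))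
    (hcard : Nat.card P = l + 2) (hI₀ : (I₀ : Set P).ncard = 1) (M : LowerSet P) :
    ∃ i < 2 * l + 4, snakeIdeal I₀ i = M := by
  have hle : (M : Set P).ncard ≤ l + 2 := hcard ▸ Set.ncard_le_card _
  rcases hM : (M : Set P).ncard with _ | k
  · refine ⟨0, by omega, ?_⟩
    rw [snakeIdeal_zero]
    exact eq_of_le_of_ncard_le bot_le (by omega)
  by_cases hk : k ≤ l
  · rcases eq_joinSeq_or_eq_otherIdeal hP hL hcard hI₀ hk hM with h | h
    · exact ⟨2 * k + 1, by omega, by rw [snakeIdeal_odd, h]⟩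
    · exact ⟨2 * k + 2, by omega, by rw [snakeIdeal_even, h]⟩
  · obtain rfl : k = l + 1 := by omega
    refine ⟨2 * (l + 1) + 1, by omega, ?_⟩
    have h := ncard_joinSeq hP hL hcard hI₀ (k := l + 1) le_rfl
    have htop : ((⊤ : LowerSet P) : Set P).ncard = l + 2 := by simp [Set.ncard_univ, hcard]
    rw [snakeIdeal_odd, eq_of_le_of_ncard_le (le_top : joinSeq I₀ (l + 1) ≤ ⊤) (by omega),
      eq_of_le_of_ncard_le (le_top : M ≤ ⊤) (by omega)]

/-- The new ideal contains some ideal that is one element smaller, hence one of the two of that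
size. It cannot contain both, since it would then equal their join. -/
theorem otherIdeal_le_iff (hP : OrdinalSumIrreducible P) (hL : WidthLeTwo (LowerSet P))
    (hcard : Nat.card P = l + 2) (hI₀ : (I₀ : Set P).ncard = 1) {k : ℕ} (hk : k < l) :
    otherIdeal (joinSeq I₀ k) ≤ otherIdeal (joinSeq I₀ (k + 1)) ↔
      ¬ joinSeq I₀ k ≤ otherIdeal (joinSeq I₀ (k + 1)) := by
  obtain ⟨h1, h2⟩ := otherIdeal_joinSeq hP hL hcard hI₀ (k := k + 1) hk
  constructor
  · intro h h'
    refine h1 (eq_of_le_of_ncard_le (sup_le h' h) ?_).symm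
    have := ncard_joinSeq hP hL hcard hI₀ (k := k + 1) (by omega)
    rw [joinSeq] at this
    omega
  · intro h
    obtain ⟨M, -, hM1, hM2⟩ := exists_ncard_eq
      (bot_le : ⊥ ≤ otherIdeal (joinSeq I₀ (k + 1))) (k := k + 1) (by simp) (by omega)
    rcases eq_joinSeq_or_eq_otherIdeal hP hL hcard hI₀ hk.le hM2 with rfl | rfl
    exacts [absurd hM1 h, hM1]

theorem snakeIdeal_covBy_iff (hP : OrdinalSumIrreducible P) (hL : WidthLeTwo (LowerSet P))
    (hcard : Nat.card P = l + 2) (hI₀ : (I₀ : Set P).ncard = 1) {i j : ℕ} (hi : i < 2 * l + 4)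
    (hj : j < 2 * l + 4) :
    snakeIdeal I₀ i ⋖ snakeIdeal I₀ j ↔ SnakeCover (snakeWord I₀) l i j := by
  rw [lowerSet_covBy_iff, ncard_snakeIdeal hP hL hcard hI₀ hi, ncard_snakeIdeal hP hL hcard hI₀ hj,
    snakeCover_iff]
  simp only [snakeLetter_snakeWord, ne_eq, snakeWord_succ_eq_iff, not_not]
  constructor
  · rintro ⟨hle, hc⟩
    by_cases h0 : i = 0
    · left; omega
    right
    obtain ⟨k, hk⟩ : ∃ k, i = 2 * k + 1 ∨ i = 2 * k + 2 := ⟨(i - 1) / 2, by omega⟩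
    obtain rfl | rfl : j = 2 * k + 3 ∨ j = 2 * k + 4 := by omega
    · exact .inl ⟨k, by omega, hk, rfl⟩
    refine .inr ⟨k, by omega, rfl, ?_⟩
    rw [show 2 * k + 4 = 2 * (k + 1) + 2 by ring, snakeIdeal_even] at hle
    rcases hk with rfl | rfl
    · rw [snakeIdeal_odd] at hle
      exact .inl ⟨hle, rfl⟩
    · rw [snakeIdeal_even, otherIdeal_le_iff hP hL hcard hI₀ (by omega)] at hle
      exact .inr ⟨hle, rfl⟩
  · rintro (⟨rfl, h⟩ | ⟨k, hk, h, rfl⟩ | ⟨k, hk, rfl, h⟩)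
    · exact ⟨bot_le, by omega⟩
    · refine ⟨?_, by omega⟩
      rw [show 2 * k + 3 = 2 * (k + 1) + 1 by ring, snakeIdeal_odd, joinSeq]
      rcases h with rfl | rfl
      · rw [snakeIdeal_odd]; exact le_sup_left
      · rw [snakeIdeal_even]; exact le_sup_right
    · refine ⟨?_, by omega⟩
      rw [show 2 * k + 4 = 2 * (k + 1) + 2 by ring, snakeIdeal_even]
      rcases h with ⟨h, rfl⟩ | ⟨h, rfl⟩
      · rwa [snakeIdeal_odd]
      · rwa [snakeIdeal_even, otherIdeal_le_iff hP hL hcard hI₀ hk]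

theorem isGeneralizedSnakePoset_of_widthLeTwo [Nontrivial P] (hP : OrdinalSumIrreducible P)
    (hL : WidthLeTwo (LowerSet P)) : IsGeneralizedSnakePoset (LowerSet P) := by
  classical
  -- Two ideals of each size $1,\dots,l+1$, together with $\emptyset$ and $P$, account for the
  -- $2l+4$ labels.
  obtain ⟨l, hcard⟩ : ∃ l, Nat.card P = l + 2 :=
    ⟨Nat.card P - 2, by have := Finite.one_lt_card (α := P); omega⟩
  obtain ⟨I₀, -, -, hI₀⟩ := exists_ncard_eq (bot_le : (⊥ : LowerSet P) ≤ ⊤) (k := 1) (by simp)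
    (by simp [Set.ncard_univ, hcard])
  let f : SnakePoset (snakeWord I₀) l → LowerSet P := fun a => snakeIdeal I₀ a.idx
  have hf : Function.Bijective f := by
    constructor
    · rintro ⟨i⟩ ⟨j⟩ h
      exact congrArg _ (Fin.ext (snakeIdeal_injective hP hL hcard hI₀ i.2 j.2 h))
    · intro M
      obtain ⟨i, hi, h⟩ := exists_snakeIdeal_eq hP hL hcard hI₀ M
      exact ⟨⟨⟨i, hi⟩⟩, h⟩
  have hcov : ∀ a b, f a ⋖ f b ↔ SnakeCover (snakeWord I₀) l a.idx b.idx := fun a b =>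
    snakeIdeal_covBy_iff hP hL hcard hI₀ a.idx.2 b.idx.2
  let e := Equiv.ofBijective f hf
  let : Fintype (LowerSet P) := Fintype.ofFinite _
  let : LocallyFiniteOrder (LowerSet P) := Fintype.toLocallyFiniteOrder
  refine ⟨l, snakeWord I₀, ⟨(OrderIso.symm ⟨e, fun {a b} => ?_⟩)⟩⟩
  change f a ≤ f b ↔ _
  -- Both orders are generated by their covers, so matching covers suffices.
  rw [le_iff_reflTransGen_covBy]
  constructor
  · intro h
    have := h.lift (p := fun a b : SnakePoset (snakeWord I₀) l =>
      SnakeCover (snakeWord I₀) l a.idx b.idx) e.symm fun M N hMN => (hcov _ _).mp <| by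
        have hfe : ∀ M, f (e.symm M) = M := e.apply_symm_apply
        rwa [hfe, hfe]
    exact (e.symm_apply_apply a) ▸ (e.symm_apply_apply b) ▸ this
  · exact fun h => Relation.ReflTransGen.lift f (fun a b hab => (hcov a b).mpr hab) _ _ h

end Isomorphism

end HibiKhovanskii

theorem theorem1p1 {𝕜 : Type u} [Field 𝕜] {P : Type v} [PartialOrder P] [Finite P] [Nontrivial P]
    (hP : OrdinalSumIrreducible P) :
    List.TFAE
      [∃ m : MonomialOrder.{v, v} (LowerSet P), IsCompatible 𝕜 m ∧
          IsKhovanskiiBasis m (hibiSet 𝕜 (LowerSet P)) (hibiAlgebra 𝕜 (LowerSet P)),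
        ∀ m : MonomialOrder.{v, v} (LowerSet P), IsCompatible 𝕜 m →
          IsKhovanskiiBasis m (hibiSet 𝕜 (LowerSet P)) (hibiAlgebra 𝕜 (LowerSet P)),
        TwoPlusTwoFree P ∧ OnePlusOnePlusOneFree P,
        IsGeneralizedSnakePoset (LowerSet P)] := by
  tfae_have 1 → 3 := fun ⟨_, hm, h⟩ => free_of_isKhovanskiiBasis hm h
  tfae_have 3 → 2 := fun h _ hm =>
    isKhovanskiiBasis_of_widthLeTwo hm (widthLeTwo_of_free h.1 h.2)
  tfae_have 2 → 1 := fun h =>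
    have ⟨m, hm⟩ := exists_isCompatible 𝕜 P
    ⟨m, hm, h m hm⟩
  tfae_have 3 → 4 := fun h =>
    isGeneralizedSnakePoset_of_widthLeTwo hP (widthLeTwo_of_free h.1 h.2)
  tfae_have 4 → 3 := fun h => free_of_widthLeTwo (widthLeTwo_of_isGeneralizedSnakePoset h)
  tfae_finish
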